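/- Let $G$ be a finite simple graph, let $\Delta(G)$ be its maximum degree, and say that $G$ has no kites if no two distinct 3-cycles of $G$ share an edge. The list total chromatic number $\chi''_l(G)$ is the least integer $k$ such that, whenever each $x\in V(G)\cup E(G)$ is assigned a list $L(x)$ of at least $k$ colors, one can choose a color from $L(x)$ for every $x\in V(G)\cup E(G)$ so that any two adjacent vertices, any two distinct edges with a common endpoint, and any edge and each of its endpoints receive different colors. If $G$ is planar, has no kites, and $\Delta(G)\geq 9$, then $\chi''_l(G)=\Delta(G)+1$. -/

import Mathlib

namespace SimpleGraph

variable {V : Type*} (G : SimpleGraph V)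

/-! ### Kites -/

/-- `G` contains a kite: two distinct 3-cycles `a b c` and `a b d` sharing the edge `a b`
(as a subgraph, not necessarily induced; `c` and `d` may be adjacent). -/
def HasKite : Prop :=
  ∃ a b c d : V, c ≠ d ∧ G.Adj a b ∧ G.Adj a c ∧ G.Adj b c ∧ G.Adj a d ∧ G.Adj b d

/-! ### Planarity

A cellular embedding of a graph in a closed orientable surface is described by its rotation system:
the cyclic order of the darts (oriented edges) leaving each vertex.  The faces are traced
by reversing a dart and then turning to the next dart in the rotation at its new origin.
A graph is planar when some rotation system embeds each component in the sphere, that is,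
has genus zero. -/

/-- A rotation system on `G`: a permutation of the darts that cyclically permutes the darts
leaving each vertex. -/
structure RotationSystem where
  /-- the next dart around the same origin -/
  rot : Equiv.Perm G.Dart
  rot_fst : ∀ d : G.Dart, (rot d).fst = d.fst
  sameCycle_of_fst_eq : ∀ d e : G.Dart, d.fst = e.fst → rot.SameCycle d e

namespace RotationSystem

variable {G} (R : G.RotationSystem)

/-- The face-tracing permutation `d ↦ rot d.symm`: the next dart along the boundary walk of
the face containing `d`. A bridge is traversed twice by the boundary walk of its face. -/
def facePerm : Equiv.Perm G.Dart :=
  (Dart.symm_involutive (G := G)).toPerm.trans R.rot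

/-- The boundary walks of faces: the orbits of the face-tracing permutation. -/
def Face : Type _ :=
  Quotient (Equiv.Perm.SameCycle.setoid R.facePerm)

/-- The rotation system has genus zero: every connected component is embedded in a sphere.
The Euler characteristic of the surface carrying a component is at most `2`, with equality exactly
for the sphere, so all the components lie on spheres iff the Euler characteristics `V - E + F`
of the components add up to twice the number of components.  A component that is a single
vertex has no dart; its sphere has one face, which is counted separately. -/
def IsGenusZero : Prop :=
  Nat.card V + (Nat.card R.Face + Nat.card {v : V // ∀ w, ¬ G.Adj v w}) =
    Nat.card G.edgeSet + 2 * Nat.card G.ConnectedComponent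

end RotationSystem

/-- A finite graph is planar if it has a rotation system of genus zero. -/
def IsPlanar : Prop :=
  ∃ R : G.RotationSystem, R.IsGenusZero

/-! ### List total colouring -/

/-- A proper total colouring: a colouring of the vertices and edges in which no two adjacent
vertices, no two distinct edges with a common endpoint, and no edge and endpoint of it have the
same colour. -/
structure IsProperTotalColoring {C : Type*} (c : V ⊕ G.edgeSet → C) : Prop where
  vertex_vertex : ∀ v w : V, G.Adj v w → c (Sum.inl v) ≠ c (Sum.inl w)
  edge_edge : ∀ e f : G.edgeSet, e ≠ f → (∃ v : V, v ∈ e.1 ∧ v ∈ f.1) →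
    c (Sum.inr e) ≠ c (Sum.inr f)
  vertex_edge : ∀ (v : V) (e : G.edgeSet), v ∈ e.1 → c (Sum.inl v) ≠ c (Sum.inr e)

/-- `G` is `k`-total-choosable: whenever every vertex and every edge is given a list of at least
`k` colours, there is a proper total colouring from the lists. -/
def TotalChoosable (k : ℕ) : Prop :=
  ∀ L : V ⊕ G.edgeSet → Finset ℕ, (∀ x, k ≤ (L x).card) →
    ∃ c : V ⊕ G.edgeSet → ℕ, G.IsProperTotalColoring c ∧ ∀ x, c x ∈ L x

/-- The list total chromatic number: the least `k` such that `G` is `k`-total-choosable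
(`⊤` if there is none). -/
noncomputable def listTotalChromaticNumber : ℕ∞ :=
  ⨅ k ∈ {k : ℕ | G.TotalChoosable k}, (k : ℕ∞)

end SimpleGraph

/-! The lower bound holds because a vertex of maximum degree and its edges need pairwise different
colours. For the upper bound fix `k = Δ(G)` and show, by induction on the number of edges, that
every subgraph `H` of `G` can be coloured from lists of size `k + 1`.

Two configurations are reducible. If `uv` is an edge with `deg u ≤ 4` and `deg u + deg v ≤ k + 1`,
colour `H - uv`, forget the colour of `u`, then colour `uv` and finally `u`
(`PairChoosable.of_deleteEdge`). If some vertices of degree two and their neighbours span even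
cycles, remove the edges of these cycles and colour the rest: every removed edge keeps two
admissible colours, and even cycles are edge-colourable from lists of size two
(`PairChoosable.of_two_regular`).

Suppose `H` has an edge and neither configuration. Neighbours of a vertex of degree two then have
degree `k`, so if there were more vertices of degree two than of degree `k`, a Hall-type argument
(`exists_two_regular_subfamily`) would produce the second configuration. Planarity gives an Euler
inequality for `H` (`IsPlanar.euler_triangles`). Faces have length at least four except for
triangles, and without kites no two triangular faces share an edge, so the excess of triangular
faces is bounded by the numbers `t(v)` of edges at `v` lying in triangles. Thus `∑ (12 deg v - 48)`
is smaller than `2 ∑ t(v)`, up to a correction for isolated vertices. Discharging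
(`no_light_edge_contradiction`) proves the opposite: vertices of large degree can pay for their low
neighbours and for their triangles. -/

namespace SimpleGraph

/-! ### Kernels, list colouring of even cycles, and Hall-type subfamilies -/

/-- For a map `f` that alternates between two classes, every finite set has a kernel. -/
theorem exists_kernel_of_alternating {X : Type*} [DecidableEq X] (f : X → X) (b : X → Bool)
    (hb : ∀ x, b (f x) ≠ b x) (Y : Finset X) :
    ∃ K ⊆ Y, (∀ x ∈ K, f x ∉ K) ∧ ∀ y ∈ Y, y ∉ K → f y ∈ K := by
  induction Y using Finset.strongInduction with
  | H Y ih =>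
    by_cases h : ∃ y ∈ Y, f y ∉ Y
    · obtain ⟨y, hy, hfy⟩ := h
      -- `y` is a sink of the digraph `x → f x` on `Y`. It goes into the kernel, and it and
      -- everything pointing at it are removed.
      have hsub : Y.filter (fun z => z ≠ y ∧ f z ≠ y) ⊂ Y := by
        refine Finset.filter_ssubset.2 ⟨y, hy, by simp⟩
      obtain ⟨K, hK, hind, hdom⟩ := ih _ hsub
      have hKY : ∀ z ∈ K, z ∈ Y ∧ z ≠ y ∧ f z ≠ y := fun z hz => Finset.mem_filter.1 (hK hz)
      refine ⟨insert y K, ?_, ?_, ?_⟩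
      · intro z hz
        rcases Finset.mem_insert.1 hz with rfl | hz
        exacts [hy, (hKY z hz).1]
      · intro z hz hfz
        rcases Finset.mem_insert.1 hz with rfl | hz
        · rcases Finset.mem_insert.1 hfz with h | h
          · exact hfy (by rwa [h])
          · exact hfy (hKY _ h).1
        · rcases Finset.mem_insert.1 hfz with h | h
          · exact (hKY z hz).2.2 h
          · exact hind z hz h
      · intro z hz hzK
        rw [Finset.mem_insert, not_or] at hzK
        by_cases hfz : f z = y
        · simp [hfz]
        · exact Finset.mem_insert_of_mem
            (hdom z (Finset.mem_filter.2 ⟨hz, hzK.1, hfz⟩) hzK.2)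
    · push Not at h
      -- With no sink left, `f` maps `Y` to itself and exchanges the two classes, so either class is
      -- a kernel.
      refine ⟨Y.filter (fun z => b z = true), Finset.filter_subset _ _, ?_, ?_⟩
      · intro x hx hfx
        have h1 := (Finset.mem_filter.1 hx).2
        have h2 := (Finset.mem_filter.1 hfx).2
        exact hb x (h2.trans h1.symm)
      · intro y hy hyK
        have h1 : b y ≠ true := fun h1 => hyK (Finset.mem_filter.2 ⟨hy, h1⟩)
        refine Finset.mem_filter.2 ⟨h y hy, ?_⟩
        have := hb y
        revert h1 this
        cases b y <;> cases b (f y) <;> simp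

/-- The graph joining each `x` to `f x` is colourable from lists of size two when `f` alternates
between two classes. -/
theorem exists_list_coloring_of_alternating {X : Type*} [DecidableEq X] (f : X → X) (b : X → Bool)
    (hb : ∀ x, b (f x) ≠ b x) (Y : Finset X) (L : X → Finset ℕ)
    (hL : ∀ x ∈ Y, 1 ≤ (L x).card ∧ (f x ∈ Y → 2 ≤ (L x).card)) :
    ∃ c : X → ℕ, (∀ x ∈ Y, c x ∈ L x) ∧ ∀ x ∈ Y, f x ∈ Y → c x ≠ c (f x) := by
  induction Y using Finset.strongInduction generalizing L with
  | H Y ih =>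
    rcases Y.eq_empty_or_nonempty with rfl | ⟨x₀, hx₀⟩
    · exact ⟨fun _ => 0, by simp, by simp⟩
    obtain ⟨a, ha⟩ := Finset.card_pos.1 (hL x₀ hx₀).1
    -- Galvin's method: give `a` to a kernel `K` of the elements that allow it. Any other element
    -- that loses `a` from its list also loses its out-neighbour, which lies in `K`, so the list
    -- condition survives.
    obtain ⟨K, hK, hind, hdom⟩ :=
      exists_kernel_of_alternating f b hb (Y.filter (fun y => a ∈ L y))
    have hKY : ∀ z ∈ K, z ∈ Y ∧ a ∈ L z := fun z hz => Finset.mem_filter.1 (hK hz)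
    have hKne : ∃ z, z ∈ K := by
      by_cases h : x₀ ∈ K
      · exact ⟨_, h⟩
      · exact ⟨_, hdom x₀ (Finset.mem_filter.2 ⟨hx₀, ha⟩) h⟩
    have hss : Y \ K ⊂ Y := by
      obtain ⟨z, hz⟩ := hKne
      refine Finset.ssubset_iff_subset_ne.2 ⟨Finset.sdiff_subset, fun h => ?_⟩
      have := (hKY z hz).1
      rw [← h] at this
      exact (Finset.mem_sdiff.1 this).2 hz
    obtain ⟨c, hc, hcp⟩ := ih _ hss (fun y => (L y).erase a) (by
      intro y hy
      obtain ⟨hy, hyK⟩ := Finset.mem_sdiff.1 hy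
      by_cases hay : a ∈ L y
      · have h1 := hdom y (Finset.mem_filter.2 ⟨hy, hay⟩) hyK
        have h2 := (hL y hy).2 (hKY _ h1).1
        rw [Finset.card_erase_of_mem hay]
        exact ⟨by omega, fun h => absurd h1 (Finset.mem_sdiff.1 h).2⟩
      · rw [Finset.erase_eq_of_notMem hay]
        exact ⟨(hL y hy).1, fun h => (hL y hy).2 (Finset.mem_sdiff.1 h).1⟩)
    refine ⟨fun x => if x ∈ K then a else c x, ?_, ?_⟩
    · intro x hx
      by_cases hxK : x ∈ K
      · simpa [hxK] using (hKY x hxK).2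
      · simpa [hxK] using Finset.mem_of_mem_erase (hc x (Finset.mem_sdiff.2 ⟨hx, hxK⟩))
    · intro x hx hfx
      by_cases hxK : x ∈ K
      · have h1 := hind x hxK
        have := Finset.ne_of_mem_erase (hc _ (Finset.mem_sdiff.2 ⟨hfx, h1⟩))
        simpa [hxK, h1] using this.symm
      · by_cases hfK : f x ∈ K
        · have := Finset.ne_of_mem_erase (hc _ (Finset.mem_sdiff.2 ⟨hx, hxK⟩))
          simpa [hxK, hfK] using this
        · simpa [hxK, hfK] using
            hcp x (Finset.mem_sdiff.2 ⟨hx, hxK⟩) (Finset.mem_sdiff.2 ⟨hfx, hfK⟩)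

/-- A family of pairs with at most as many elements in its union as members contains a
two-regular subfamily. -/
theorem exists_two_regular_subfamily {ι α : Type*} [DecidableEq ι] [DecidableEq α]
    (t : ι → Finset α) (S : Finset ι) (ht : ∀ i ∈ S, (t i).card = 2) (hS : S.Nonempty)
    (h : (S.biUnion t).card ≤ S.card) :
    ∃ S' ⊆ S, S'.Nonempty ∧ ∃ m o : ι → α, Set.InjOn m S' ∧ Set.InjOn o S' ∧
      S'.image m = S'.image o ∧ ∀ i ∈ S', m i ≠ o i ∧ t i = {m i, o i} := by
  induction S using Finset.strongInduction with
  | H S ih =>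
    by_cases hmin : ∃ T ⊂ S, T.Nonempty ∧ (T.biUnion t).card ≤ T.card
    · obtain ⟨T, hT, hTne, hTc⟩ := hmin
      obtain ⟨S', hS', rest⟩ := ih T hT (fun i hi => ht i (hT.1 hi)) hTne hTc
      exact ⟨S', hS'.trans hT.1, rest⟩
    -- For a minimal `S`, proper nonempty subfamilies have strictly larger unions. This is Hall's
    -- condition, and it makes the union of `S` exactly as large as `S`.
    push Not at hmin
    obtain ⟨i₀, hi₀⟩ := hS
    have h2 : 2 ≤ (S.biUnion t).card :=
      (ht i₀ hi₀) ▸ Finset.card_le_card (Finset.subset_biUnion_of_mem t hi₀)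
    have herase : ∀ i ∈ S, S.card - 1 < ((S.erase i).biUnion t).card := by
      intro i hi
      rw [← Finset.card_erase_of_mem hi]
      refine hmin _ (Finset.erase_ssubset hi) (Finset.card_pos.1 ?_)
      rw [Finset.card_erase_of_mem hi]; omega
    have hcard : (S.biUnion t).card = S.card := by
      have h1 := herase i₀ hi₀
      have h3 : ((S.erase i₀).biUnion t).card ≤ (S.biUnion t).card :=
        Finset.card_le_card (Finset.biUnion_subset_biUnion_of_subset_left _ (Finset.erase_subset _ _))
      omega
    obtain ⟨m', hm'inj, hm'⟩ := (Finset.all_card_le_biUnion_card_iff_exists_injective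
      (fun i : S => t i)).1 (by
        intro s
        have e : s.biUnion (fun i : S => t i) = (s.map (Function.Embedding.subtype _)).biUnion t := by
          ext; simp
        rw [e, ← Finset.card_map (Function.Embedding.subtype _)]
        have hsub : s.map (Function.Embedding.subtype _) ⊆ S := by
          intro x hx; simp at hx; exact hx.1
        rcases hsub.eq_or_ssubset with h' | h'
        · rw [h', hcard]
        · rcases (s.map (Function.Embedding.subtype _)).eq_empty_or_nonempty with h0 | h0
          · rw [h0]; simp
          · exact (hmin _ h' h0).le)
    have hoex : ∀ i : S, ∃ y, m' i ≠ y ∧ t i = {m' i, y} := by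
      intro i
      obtain ⟨x, y, hxy, hte⟩ := Finset.card_eq_two.1 (ht i i.2)
      have := hm' i
      rw [hte] at this
      rcases Finset.mem_insert.1 this with h | h
      · exact ⟨y, by rw [h]; exact hxy, by rw [h, hte]⟩
      · rw [Finset.mem_singleton] at h
        exact ⟨x, by rw [h]; exact hxy.symm, by rw [h, hte, Finset.pair_comm]⟩
    choose o' ho'ne ho' using hoex
    have : Nonempty α := ⟨m' ⟨i₀, hi₀⟩⟩
    let m : ι → α := fun i => if hi : i ∈ S then m' ⟨i, hi⟩ else Classical.arbitrary α
    let o : ι → α := fun i => if hi : i ∈ S then o' ⟨i, hi⟩ else Classical.arbitrary α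
    have hm : ∀ i (hi : i ∈ S), m i = m' ⟨i, hi⟩ := fun i hi => dif_pos hi
    have ho : ∀ i (hi : i ∈ S), o i = o' ⟨i, hi⟩ := fun i hi => dif_pos hi
    have hmo : ∀ i ∈ S, m i ≠ o i ∧ t i = {m i, o i} := by
      intro i hi
      rw [hm i hi, ho i hi]
      exact ⟨ho'ne _, ho' ⟨i, hi⟩⟩
    have hminj : Set.InjOn m S := by
      intro i hi j hj hij
      rw [hm i hi, hm j hj] at hij
      exact congrArg Subtype.val (hm'inj hij)
    have himm : S.image m = S.biUnion t := by
      refine Finset.eq_of_subset_of_card_le ?_ ?_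
      · intro x hx
        obtain ⟨i, hi, rfl⟩ := Finset.mem_image.1 hx
        exact Finset.mem_biUnion.2 ⟨i, hi, by rw [(hmo i hi).2]; simp⟩
      · rw [Finset.card_image_of_injOn hminj, hcard]
    have himo : S.image o = S.biUnion t := by
      refine Finset.Subset.antisymm ?_ ?_
      · intro x hx
        obtain ⟨i, hi, rfl⟩ := Finset.mem_image.1 hx
        exact Finset.mem_biUnion.2 ⟨i, hi, by rw [(hmo i hi).2]; simp⟩
      · intro v hv
        have hv' := hv
        rw [← himm] at hv'
        obtain ⟨i, hi, rfl⟩ := Finset.mem_image.1 hv'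
        by_contra hno
        -- An element covered only as `m i` would vanish from the union once `i` is erased, against
        -- minimality. So `o` is onto the union, and injective by cardinality.
        have hsub : (S.erase i).biUnion t ⊆ (S.biUnion t).erase (m i) := by
          intro x hx
          obtain ⟨j, hj, hxj⟩ := Finset.mem_biUnion.1 hx
          obtain ⟨hji, hjS⟩ := Finset.mem_erase.1 hj
          refine Finset.mem_erase.2 ⟨?_, Finset.mem_biUnion.2 ⟨j, hjS, hxj⟩⟩
          rintro rfl
          rw [(hmo j hjS).2] at hxj
          rcases Finset.mem_insert.1 hxj with h | h
          · exact hji (hminj hjS hi h.symm)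
          · exact hno (Finset.mem_image.2 ⟨j, hjS, (Finset.mem_singleton.1 h).symm⟩)
        have h1 := Finset.card_le_card hsub
        rw [Finset.card_erase_of_mem hv, hcard] at h1
        exact absurd (herase i hi) (by omega)
    refine ⟨S, subset_rfl, ⟨i₀, hi₀⟩, m, o, hminj, ?_, himm.trans himo.symm, hmo⟩
    rw [← Finset.card_image_iff, himo, hcard]

end SimpleGraph

/-! ### Reducible configurations -/

namespace SimpleGraph

variable {V : Type*}

/-- `H` can be totally coloured from any lists of size `k`, where lists are given to all vertices
and to all unordered pairs of vertices. -/
def PairChoosable (H : SimpleGraph V) (k : ℕ) : Prop :=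
  ∀ (Lv : V → Finset ℕ) (Le : Sym2 V → Finset ℕ), (∀ v, k ≤ (Lv v).card) →
    (∀ e, k ≤ (Le e).card) → ∃ (cv : V → ℕ) (ce : Sym2 V → ℕ),
      (∀ v, cv v ∈ Lv v) ∧ (∀ e, ce e ∈ Le e) ∧ (∀ u v, H.Adj u v → cv u ≠ cv v) ∧
      (∀ u v w, H.Adj u v → H.Adj u w → v ≠ w → ce s(u, v) ≠ ce s(u, w)) ∧
      ∀ u v, H.Adj u v → cv u ≠ ce s(u, v)

/-- Lists on all pairs let one list assignment serve a graph and all its subgraphs during the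
induction. Here the non-edges receive the filler list `range k`. -/
theorem PairChoosable.totalChoosable {H : SimpleGraph V} {k : ℕ} (h : H.PairChoosable k) :
    H.TotalChoosable k := by
  classical
  intro L hL
  obtain ⟨cv, ce, hcv, hce, hvv, hee, hve⟩ := h (fun v => L (Sum.inl v))
    (fun e => if he : e ∈ H.edgeSet then L (Sum.inr ⟨e, he⟩) else Finset.range k)
    (fun v => hL _) (fun e => by
      by_cases he : e ∈ H.edgeSet
      · simpa only [he, dif_pos] using hL _
      · simp only [he, dif_neg, not_false_eq_true, Finset.card_range, le_refl])
  refine ⟨Sum.elim cv (fun e => ce e.1), ⟨hvv, ?_, ?_⟩, ?_⟩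
  · rintro ⟨e, he⟩ ⟨f, hf⟩ hne ⟨v, hve, hvf⟩
    obtain ⟨x, rfl⟩ := Sym2.mem_iff_exists.1 hve
    obtain ⟨y, rfl⟩ := Sym2.mem_iff_exists.1 hvf
    exact hee v x y he hf (by rintro rfl; exact hne rfl)
  · rintro v ⟨e, he⟩ hv
    obtain ⟨x, rfl⟩ := Sym2.mem_iff_exists.1 hv
    exact hve v x he
  · rintro (v | ⟨e, he⟩)
    · exact hcv v
    · have := hce e
      simp only [he, dif_pos] at this
      exact this

theorem pairChoosable_of_forall_not_adj {H : SimpleGraph V} {k : ℕ} (hk : 0 < k)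
    (h : ∀ u v, ¬ H.Adj u v) : H.PairChoosable k := by
  intro Lv Le hv he
  choose cv hcv using fun v => Finset.card_pos.1 (hk.trans_le (hv v))
  choose ce hce using fun e => Finset.card_pos.1 (hk.trans_le (he e))
  exact ⟨cv, ce, hcv, hce, fun u v h' => absurd h' (h u v), fun u v _ h' => absurd h' (h u v),
    fun u v h' => absurd h' (h u v)⟩

theorem exists_mem_notMem_of_card_lt {s t : Finset ℕ} (h : t.card < s.card) :
    ∃ a ∈ s, a ∉ t := by
  by_contra! hc
  exact absurd (Finset.card_le_card (fun a ha => hc a ha)) (by omega)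

variable [Fintype V]

open Classical in
/-- Recolouring an independent set of vertices of small degree. -/
theorem exists_vertex_recoloring {H : SimpleGraph V} {k : ℕ} (S : Finset V)
    (hS : ∀ u ∈ S, ∀ v ∈ S, ¬ H.Adj u v) (hdeg : ∀ u ∈ S, 2 * H.degree u < k)
    (Lv : V → Finset ℕ) (hLv : ∀ v, k ≤ (Lv v).card) (ce : Sym2 V → ℕ) (cv : V → ℕ)
    (hcv : ∀ v, cv v ∈ Lv v) (hvv : ∀ u v, u ∉ S → v ∉ S → H.Adj u v → cv u ≠ cv v)
    (hve : ∀ u v, u ∉ S → H.Adj u v → cv u ≠ ce s(u, v)) :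
    ∃ cv' : V → ℕ, (∀ v, cv' v ∈ Lv v) ∧ (∀ u v, H.Adj u v → cv' u ≠ cv' v) ∧
      ∀ u v, H.Adj u v → cv' u ≠ ce s(u, v) := by
  have key : ∀ u ∈ S, ∃ a ∈ Lv u, a ∉ (H.neighborFinset u).image cv ∪
      (H.neighborFinset u).image (fun x => ce s(u, x)) := by
    intro u hu
    refine exists_mem_notMem_of_card_lt ?_
    have h1 := Finset.card_union_le ((H.neighborFinset u).image cv)
      ((H.neighborFinset u).image (fun x => ce s(u, x)))
    have h2 := Finset.card_image_le (s := H.neighborFinset u) (f := cv)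
    have h3 := Finset.card_image_le (s := H.neighborFinset u) (f := fun x => ce s(u, x))
    have h4 := hdeg u hu
    have h5 := hLv u
    rw [card_neighborFinset_eq_degree] at h2 h3
    omega
  choose! a haL ha using key
  have ha1 : ∀ u ∈ S, ∀ v, H.Adj u v → a u ≠ cv v := fun u hu v huv h =>
    ha u hu (Finset.mem_union_left _ (Finset.mem_image.2 ⟨v, by simpa using huv, h.symm⟩))
  have ha2 : ∀ u ∈ S, ∀ v, H.Adj u v → a u ≠ ce s(u, v) := fun u hu v huv h =>
    ha u hu (Finset.mem_union_right _ (Finset.mem_image.2 ⟨v, by simpa using huv, h.symm⟩))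
  refine ⟨fun v => if v ∈ S then a v else cv v, ?_, ?_, ?_⟩
  · intro v
    by_cases hv : v ∈ S
    · simpa [hv] using haL v hv
    · simpa [hv] using hcv v
  · intro u v huv
    by_cases hu : u ∈ S <;> by_cases hv : v ∈ S
    · exact absurd huv (hS u hu v hv)
    · simpa [hu, hv] using ha1 u hu v huv
    · simpa [hu, hv] using (ha1 v hv u huv.symm).symm
    · simpa [hu, hv] using hvv u v hu hv huv
  · intro u v huv
    by_cases hu : u ∈ S
    · simpa [hu] using ha2 u hu v huv
    · simpa [hu] using hve u v hu huv

open Classical in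
/-- An edge of small weight with an end of small degree is reducible. -/
theorem PairChoosable.of_deleteEdge {H : SimpleGraph V} {k : ℕ} {u v : V} (huv : H.Adj u v)
    (hu : 2 * H.degree u < k) (hsum : H.degree u + H.degree v ≤ k)
    (h : (H.deleteEdges {s(u, v)}).PairChoosable k) : H.PairChoosable k := by
  intro Lv Le hLv hLe
  obtain ⟨cv, ce, hcv, hce, hvv, hee, hve⟩ := h Lv Le hLv hLe
  simp only [deleteEdges_adj, Set.mem_singleton_iff] at hvv hee hve
  have huv' : u ≠ v := huv.ne
  -- The new edge avoids `cv v` and the other edges at `u` and `v`: at most `1 + (deg u - 1) + (deg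
  -- v - 1) < k` colours. The colour of `u` is ignored, as `u` is recoloured last.
  obtain ⟨a, haL, ha⟩ : ∃ a ∈ Le s(u, v), a ∉ insert (cv v)
      (((H.neighborFinset u).erase v).image (fun x => ce s(u, x)) ∪
        ((H.neighborFinset v).erase u).image (fun x => ce s(v, x))) := by
    refine exists_mem_notMem_of_card_lt ?_
    have h1 := Finset.card_union_le (((H.neighborFinset u).erase v).image (fun x => ce s(u, x)))
      (((H.neighborFinset v).erase u).image (fun x => ce s(v, x)))
    have h2 := Finset.card_image_le (s := (H.neighborFinset u).erase v) (f := fun x => ce s(u, x))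
    have h3 := Finset.card_image_le (s := (H.neighborFinset v).erase u) (f := fun x => ce s(v, x))
    rw [Finset.card_erase_of_mem (by simpa using huv), card_neighborFinset_eq_degree] at h2
    rw [Finset.card_erase_of_mem (by simpa using huv.symm), card_neighborFinset_eq_degree] at h3
    have h4 := hLe s(u, v)
    have h5 : 0 < H.degree u := (H.degree_pos_iff_exists_adj u).2 ⟨v, huv⟩
    have h6 : 0 < H.degree v := (H.degree_pos_iff_exists_adj v).2 ⟨u, huv.symm⟩
    have h7 := Finset.card_insert_le (cv v)
      (((H.neighborFinset u).erase v).image (fun x => ce s(u, x)) ∪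
        ((H.neighborFinset v).erase u).image (fun x => ce s(v, x)))
    omega
  simp only [Finset.mem_insert, Finset.mem_union, Finset.mem_image, Finset.mem_erase,
    mem_neighborFinset, not_or, not_exists, not_and, and_imp] at ha
  obtain ⟨hav, hau, havv⟩ := ha
  have hnew : ∀ x y, H.Adj x y → s(x, y) ≠ s(u, v) → (x = u ∨ x = v) → ce s(x, y) ≠ a := by
    rintro x y hxy hne (rfl | rfl)
    · exact hau y (by rintro rfl; exact hne rfl) hxy
    · exact havv y (by rintro rfl; exact hne Sym2.eq_swap) hxy
  have hmem : ∀ x y, s(x, y) = s(u, v) → x = u ∨ x = v := by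
    intro x y h
    have : x ∈ s(u, v) := h ▸ Sym2.mem_mk_left x y
    simpa using this
  set ce' : Sym2 V → ℕ := fun e => if e = s(u, v) then a else ce e with hce'
  obtain ⟨cv', h1, h2, h3⟩ := exists_vertex_recoloring (H := H) {u} (by simp) (by simpa using hu)
    Lv hLv ce' cv hcv (by
      intro x y hx hy hxy
      refine hvv x y ⟨hxy, fun h => ?_⟩
      rcases Sym2.eq_iff.1 h with h | h
      · exact hx (by simp [h.1])
      · exact hy (by simp [h.2])) (by
      intro x y hx hxy
      by_cases h : s(x, y) = s(u, v)
      · have : x = v := (hmem x y h).resolve_left (by simpa using hx)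
        simp only [hce', h, if_true]
        rw [this]; exact fun h => hav h.symm
      · simp only [hce', h, if_false]
        exact hve x y ⟨hxy, h⟩)
  refine ⟨cv', ce', h1, ?_, h2, ?_, h3⟩
  · intro e
    by_cases he : e = s(u, v)
    · simpa [hce', he] using haL
    · simpa [hce', he] using hce e
  · intro x y z hxy hxz hyz
    have hne : s(x, y) ≠ s(x, z) := fun h => hyz (Sym2.congr_right.1 h)
    by_cases h : s(x, y) = s(u, v)
    · have h' : s(x, z) ≠ s(u, v) := fun h' => hne (h.trans h'.symm)
      simp only [hce', h, h', if_true, if_false]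
      exact (hnew x z hxz h' (hmem x y h)).symm
    · by_cases h' : s(x, z) = s(u, v)
      · simp only [hce', h, h', if_true, if_false]
        exact hnew x y hxy h (hmem x z h')
      · simp only [hce', h, h', if_false]
        exact hee x y z ⟨hxy, h⟩ ⟨hxz, h'⟩ hyz

open Classical in
/-- A two-regular bipartite configuration of edges between vertices of degree two and vertices of
degree less than `k` is reducible. -/
theorem PairChoosable.of_two_regular {H : SimpleGraph V} {k : ℕ} (hk : 4 < k) (S : Finset V)
    (m o : V → V) (hm : Set.InjOn m S) (ho : Set.InjOn o S) (himg : S.image m = S.image o)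
    (hmo : ∀ w ∈ S, m w ≠ o w ∧ H.neighborFinset w = {m w, o w})
    (hS : ∀ u ∈ S, ∀ v ∈ S, ¬ H.Adj u v) (hdeg : ∀ v, H.degree v < k)
    (h : (H.deleteEdges {e | ∃ w ∈ S, w ∈ e}).PairChoosable k) : H.PairChoosable k := by
  intro Lv Le hLv hLe
  obtain ⟨cv, ce, hcv, hce, hvv, hee, hve⟩ := h Lv Le hLv hLe
  have hadj : ∀ u v, (H.deleteEdges {e | ∃ w ∈ S, w ∈ e}).Adj u v ↔
      H.Adj u v ∧ u ∉ S ∧ v ∉ S := by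
    intro u v
    simp only [deleteEdges_adj, Set.mem_ofPred_eq, Sym2.mem_iff, not_exists, not_and, not_or]
    constructor
    · rintro ⟨h1, h2⟩
      exact ⟨h1, fun hu => (h2 u hu).1 rfl, fun hv => (h2 v hv).2 rfl⟩
    · rintro ⟨h1, h2, h3⟩
      exact ⟨h1, fun w hw => ⟨by rintro rfl; exact h2 hw, by rintro rfl; exact h3 hw⟩⟩
  simp only [hadj] at hvv hee hve
  have hnb : ∀ w ∈ S, ∀ x, H.Adj w x ↔ x = m w ∨ x = o w := by
    intro w hw x
    rw [← mem_neighborFinset, (hmo w hw).2]; simp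
  have hmS : ∀ w ∈ S, m w ∉ S := fun w hw h => hS w hw _ h ((hnb w hw _).2 (Or.inl rfl))
  have hoS : ∀ w ∈ S, o w ∉ S := fun w hw h => hS w hw _ h ((hnb w hw _).2 (Or.inr rfl))
  have hpre : ∀ w, ∃ w', w ∈ S → w' ∈ S ∧ m w' = o w := by
    intro w
    by_cases hw : w ∈ S
    · have : o w ∈ S.image m := himg ▸ Finset.mem_image_of_mem o hw
      obtain ⟨w', hw', h⟩ := Finset.mem_image.1 this
      exact ⟨w', fun _ => ⟨hw', h⟩⟩
    · exact ⟨w, fun h => absurd h hw⟩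
  choose g hg using hpre
  let far : V × Bool → V := fun x => if x.2 then m x.1 else o x.1
  let edge : V × Bool → Sym2 V := fun x => s(x.1, far x)
  -- A pair `(w, b)` stands for one of the two edges at `w`. The map `f` walks along the cycles:
  -- from `w m(w)` to `w o(w)`, then through `o(w)` to the edge `g(w) m(g(w))`. The Boolean
  -- alternates, so the cycles are even.
  let f : V × Bool → V × Bool := fun x => if x.2 then (x.1, false) else (g x.1, true)
  let Y : Finset (V × Bool) := S ×ˢ Finset.univ
  have hY : ∀ x, x ∈ Y ↔ x.1 ∈ S := fun x => by simp [Y]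
  have hfarS : ∀ x ∈ Y, far x ∉ S := by
    rintro ⟨w, _ | _⟩ hx
    · exact hoS w ((hY _).1 hx)
    · exact hmS w ((hY _).1 hx)
  have hfarimg : ∀ x ∈ Y, ∃ p ∈ S, m p = far x := by
    rintro ⟨w, _ | _⟩ hx
    · exact ⟨g w, hg w ((hY _).1 hx)⟩
    · exact ⟨w, (hY _).1 hx, rfl⟩
  have hedge : Set.InjOn edge Y := by
    intro x hx y hy hxy
    rw [Finset.mem_coe] at hx hy
    have h1 : x.1 = y.1 ∧ far x = far y := by
      rcases Sym2.eq_iff.1 hxy with h | h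
      · exact h
      · exact absurd ((hY x).1 hx) (h.1 ▸ hfarS y hy)
    obtain ⟨w, b⟩ := x
    obtain ⟨w', b'⟩ := y
    obtain ⟨rfl, h2⟩ := h1
    have := (hmo w ((hY _).1 hx)).1
    cases b <;> cases b' <;> simp_all [far]
  let forb : V → Finset ℕ := fun v =>
    insert (cv v) (((H.neighborFinset v) \ S).image (fun x => ce s(v, x)))
  -- The far end has at least two neighbours in `S`, so at most `deg - 2` coloured edges and its own
  -- colour are forbidden. As `deg < k`, two colours remain.
  have hforb : ∀ x ∈ Y, (forb (far x)).card + 2 ≤ k := by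
    intro x hx
    obtain ⟨p, hp, hpx⟩ := hfarimg x hx
    have hq : far x ∈ S.image o := himg ▸ (hpx ▸ Finset.mem_image_of_mem m hp)
    obtain ⟨q, hq, hqx⟩ := Finset.mem_image.1 hq
    have hpq : p ≠ q := by
      rintro rfl
      exact (hmo p hp).1 (hpx.trans hqx.symm)
    have h1 : ({p, q} : Finset V) ⊆ H.neighborFinset (far x) ∩ S := by
      intro y hy
      rcases Finset.mem_insert.1 hy with rfl | hy
      · refine Finset.mem_inter.2 ⟨?_, hp⟩
        rw [mem_neighborFinset]
        exact ((hnb y hp _).2 (Or.inl hpx.symm)).symm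
      · rw [Finset.mem_singleton] at hy
        subst hy
        refine Finset.mem_inter.2 ⟨?_, hq⟩
        rw [mem_neighborFinset]
        exact ((hnb y hq _).2 (Or.inr hqx.symm)).symm
    have h2 := Finset.card_le_card h1
    rw [Finset.card_pair hpq] at h2
    have h3 := Finset.card_sdiff_add_card_inter (H.neighborFinset (far x)) S
    rw [card_neighborFinset_eq_degree] at h3
    have h4 := hdeg (far x)
    have h5 := Finset.card_insert_le (cv (far x))
      (((H.neighborFinset (far x)) \ S).image (fun y => ce s(far x, y)))
    have h6 := Finset.card_image_le (s := (H.neighborFinset (far x)) \ S)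
      (f := fun y => ce s(far x, y))
    simp only [forb]
    omega
  obtain ⟨c, hcL, hcf⟩ := exists_list_coloring_of_alternating f (fun x => x.2)
    (by rintro ⟨w, _ | _⟩ <;> simp [f]) Y (fun x => Le (edge x) \ forb (far x)) (by
      intro x hx
      have h1 := hforb x hx
      have h2 := hLe (edge x)
      have h3 := Finset.le_card_sdiff (forb (far x)) (Le (edge x))
      constructor
      · omega
      · intro _; omega)
  have hext : ∀ e, ∃ a, (∀ x ∈ Y, edge x = e → a = c x) ∧ ((∀ x ∈ Y, edge x ≠ e) → a = ce e) := by
    intro e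
    by_cases he : ∃ x ∈ Y, edge x = e
    · obtain ⟨x, hx, rfl⟩ := he
      exact ⟨c x, fun y hy hyx => by rw [hedge hy hx hyx], fun h => absurd rfl (h x hx)⟩
    · push Not at he
      exact ⟨ce e, fun x hx hxe => absurd hxe (he x hx), fun _ => rfl⟩
  choose ce' hnew' hold' using hext
  have hnew : ∀ x ∈ Y, ce' (edge x) = c x := fun x hx => hnew' _ x hx rfl
  have hold : ∀ u v, u ∉ S → v ∉ S → ce' s(u, v) = ce s(u, v) := by
    intro u v hu hv
    refine hold' _ fun x hx hxe => ?_
    have : x.1 ∈ s(u, v) := hxe ▸ Sym2.mem_mk_left _ _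
    rcases Sym2.mem_iff.1 this with h | h
    · exact hu (h ▸ (hY x).1 hx)
    · exact hv (h ▸ (hY x).1 hx)
  have hcov : ∀ w ∈ S, ∀ y, H.Adj w y → ∃ b, far (w, b) = y := by
    intro w hw y hwy
    rcases (hnb w hw y).1 hwy with rfl | rfl
    exacts [⟨true, rfl⟩, ⟨false, rfl⟩]
  have hval : ∀ w ∈ S, ∀ b, ce' s(w, far (w, b)) = c (w, b) := fun w hw b =>
    hnew (w, b) ((hY _).2 hw)
  have hcforb : ∀ w ∈ S, ∀ b, c (w, b) ∉ forb (far (w, b)) := fun w hw b =>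
    (Finset.mem_sdiff.1 (hcL _ ((hY (w, b)).2 hw))).2
  have htf : ∀ w ∈ S, c (w, true) ≠ c (w, false) := fun w hw =>
    hcf (w, true) ((hY _).2 hw) ((hY _).2 hw)
  have hft : ∀ v ∈ S, ∀ w ∈ S, m v = o w → c (w, false) ≠ c (v, true) := by
    intro v hv w hw h
    have hgv : g w = v := hm (hg w hw).1 hv ((hg w hw).2.trans h.symm)
    have := hcf (w, false) ((hY _).2 hw) ((hY _).2 (hg w hw).1)
    simpa [f, hgv] using this
  have hmixed : ∀ u v w, H.Adj u v → H.Adj u w → u ∉ S → v ∈ S → w ∉ S →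
      ce' s(u, v) ≠ ce' s(u, w) := by
    intro u v w huv huw hu hv hw h
    obtain ⟨b, rfl⟩ := hcov v hv u huv.symm
    rw [Sym2.eq_swap, hval v hv, hold _ _ hu hw] at h
    refine hcforb v hv b (Finset.mem_insert_of_mem (Finset.mem_image.2 ⟨w, ?_, h.symm⟩))
    simpa using ⟨huw, hw⟩
  have hdeg2 : ∀ w ∈ S, H.degree w = 2 := by
    intro w hw
    rw [← card_neighborFinset_eq_degree, (hmo w hw).2, Finset.card_pair (hmo w hw).1]
  obtain ⟨cv', h1, h2, h3⟩ := exists_vertex_recoloring (H := H) S hS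
    (fun u hu => by rw [hdeg2 u hu]; exact hk) Lv hLv ce' cv hcv
    (fun x y hx hy hxy => hvv x y ⟨hxy, hx, hy⟩) (by
      intro x y hx hxy
      by_cases hy : y ∈ S
      · obtain ⟨b, rfl⟩ := hcov y hy x hxy.symm
        rw [Sym2.eq_swap, hval y hy]
        intro h
        exact hcforb y hy b (h ▸ Finset.mem_insert_self _ _)
      · rw [hold _ _ hx hy]
        exact hve x y ⟨hxy, hx, hy⟩)
  refine ⟨cv', ce', h1, ?_, h2, ?_, h3⟩
  · intro e
    by_cases he : ∃ x ∈ Y, edge x = e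
    · obtain ⟨x, hx, rfl⟩ := he
      rw [hnew x hx]
      exact (Finset.mem_sdiff.1 (hcL x hx)).1
    · push Not at he
      rw [hold' e he]
      exact hce e
  · intro u v w huv huw hvw
    by_cases hu : u ∈ S
    · obtain ⟨b, rfl⟩ := hcov u hu v huv
      obtain ⟨b', rfl⟩ := hcov u hu w huw
      rw [hval u hu, hval u hu]
      cases b <;> cases b'
      · exact absurd rfl hvw
      · exact (htf u hu).symm
      · exact htf u hu
      · exact absurd rfl hvw
    · by_cases hv : v ∈ S <;> by_cases hw : w ∈ S
      · obtain ⟨b, hb⟩ := hcov v hv u huv.symm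
        obtain ⟨b', hb'⟩ := hcov w hw u huw.symm
        have e1 : ce' s(u, v) = c (v, b) := by rw [Sym2.eq_swap, ← hb, hval v hv]
        have e2 : ce' s(u, w) = c (w, b') := by rw [Sym2.eq_swap, ← hb', hval w hw]
        rw [e1, e2]
        have hbb := hb.trans hb'.symm
        cases b <;> cases b'
        · exact absurd (ho hv hw hbb) hvw
        · exact hft w hw v hv hbb.symm
        · exact (hft v hv w hw hbb).symm
        · exact absurd (hm hv hw hbb) hvw
      · exact hmixed u v w huv huw hu hv hw
      · exact (hmixed u w v huw huv hu hw hv).symm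
      · rw [hold _ _ hu hv, hold _ _ hu hw]
        exact hee u v w ⟨huv, hu, hv⟩ ⟨huw, hu, hw⟩ hvw

end SimpleGraph

/-! ### Orbits under transpositions, components, and Euler's inequality for subgraphs -/

namespace SimpleGraph

section Setoids

variable {X : Type*}

theorem rel_of_sameCycle (r : Setoid X) (f : Equiv.Perm X) (h : ∀ x, r x (f x)) {x y : X}
    (hxy : f.SameCycle x y) : r x y := by
  obtain ⟨i, rfl⟩ := hxy
  induction i using Int.induction_on with
  | zero => exact r.refl x
  | succ i ih =>
    rw [add_comm, zpow_add, zpow_one]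
    exact r.trans ih (h _)
  | pred i ih =>
    refine r.trans ih (r.symm ?_)
    have := h ((f ^ (-(i : ℤ) - 1)) x)
    rwa [← Equiv.Perm.mul_apply, ← zpow_one_add, add_sub_cancel] at this

/-- The setoid obtained from `r` by identifying the classes of `p` and `q`. -/
def mergeSetoid (r : Setoid X) (p q : X) : Setoid X where
  r x y := r x y ∨ (r x p ∧ r q y) ∨ (r x q ∧ r p y)
  iseqv := by
    refine ⟨fun x => Or.inl (r.refl x), ?_, ?_⟩
    · rintro x y (h | ⟨h, h'⟩ | ⟨h, h'⟩)
      · exact Or.inl (r.symm h)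
      · exact Or.inr (Or.inr ⟨r.symm h', r.symm h⟩)
      · exact Or.inr (Or.inl ⟨r.symm h', r.symm h⟩)
    · rintro x y z (h | ⟨h, h'⟩ | ⟨h, h'⟩) (k | ⟨k, k'⟩ | ⟨k, k'⟩)
      · exact Or.inl (r.trans h k)
      · exact Or.inr (Or.inl ⟨r.trans h k, k'⟩)
      · exact Or.inr (Or.inr ⟨r.trans h k, k'⟩)
      · exact Or.inr (Or.inl ⟨h, r.trans h' k⟩)
      · exact Or.inr (Or.inl ⟨h, k'⟩)
      · exact Or.inl (r.trans h k')
      · exact Or.inr (Or.inr ⟨h, r.trans h' k⟩)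
      · exact Or.inl (r.trans h k')
      · exact Or.inr (Or.inr ⟨h, k'⟩)

theorem mergeSetoid_self (r : Setoid X) (p q : X) : mergeSetoid r p q p q :=
  Or.inr (Or.inl ⟨r.refl p, r.refl q⟩)

theorem rel_of_mergeSetoid {r : Setoid X} {p q x y : X} (hpq : r p q)
    (h : mergeSetoid r p q x y) : r x y := by
  rcases h with h | ⟨h, h'⟩ | ⟨h, h'⟩
  · exact h
  · exact r.trans h (r.trans hpq h')
  · exact r.trans h (r.trans (r.symm hpq) h')

theorem mergeSetoid_of_sameCycle_mul_swap [DecidableEq X] (f : Equiv.Perm X) (p q : X) {x y : X}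
    (h : (f * Equiv.swap p q).SameCycle x y) :
    mergeSetoid (Equiv.Perm.SameCycle.setoid f) p q x y := by
  refine rel_of_sameCycle _ _ (fun x => ?_) h
  have hf : ∀ z, (Equiv.Perm.SameCycle.setoid f) z (f z) := fun z =>
    (Equiv.Perm.sameCycle_apply_right).2 (Equiv.Perm.SameCycle.refl f z)
  rw [Equiv.Perm.mul_apply]
  by_cases hp : x = p
  · subst hp
    rw [Equiv.swap_apply_left]
    exact Or.inr (Or.inl ⟨Setoid.refl' _ _, hf q⟩)
  · by_cases hq : x = q
    · subst hq
      rw [Equiv.swap_apply_right]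
      exact Or.inr (Or.inr ⟨Setoid.refl' _ _, hf p⟩)
    · rw [Equiv.swap_apply_of_ne_of_ne hp hq]
      exact Or.inl (hf x)

variable [Finite X]

theorem card_quotient_le_of_le {r s : Setoid X} (h : ∀ x y, r x y → s x y) :
    Nat.card (Quotient s) ≤ Nat.card (Quotient r) := by
  refine Nat.card_le_card_of_surjective
    (Quotient.map' (s₁ := r) (s₂ := s) id (fun x y hxy => h x y hxy)) ?_
  rintro ⟨x⟩
  exact ⟨Quotient.mk r x, rfl⟩

theorem card_quotient_lt_of_lt {r s : Setoid X} (h : ∀ x y, r x y → s x y) {p q : X}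
    (hs : s p q) (hr : ¬ r p q) : Nat.card (Quotient s) < Nat.card (Quotient r) := by
  have hsurj : Function.Surjective
      (Quotient.map' (s₁ := r) (s₂ := s) id (fun x y hxy => h x y hxy)) := by
    rintro ⟨x⟩
    exact ⟨Quotient.mk r x, rfl⟩
  refine lt_of_le_of_ne (card_quotient_le_of_le h) fun he => ?_
  have hinj := (hsurj.bijective_of_nat_card_le he.ge).1
  have : Quotient.mk r p = Quotient.mk r q := hinj (Quotient.sound (s := s) hs)
  exact hr (Quotient.exact this)

/-- Setting aside the class of `p`, distinct `s`-classes stay distinct modulo `r`, since the merge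
could only have joined the classes of `p` and `q`. -/
theorem card_quotient_le_succ_of_le_merge {r s : Setoid X} {p q : X}
    (h : ∀ x y, r x y → mergeSetoid s p q x y) :
    Nat.card (Quotient s) ≤ Nat.card (Quotient r) + 1 := by
  classical
  rw [← Finite.card_option]
  refine Nat.card_le_card_of_injective (fun C : Quotient s =>
    if s C.out p then none else some (Quotient.mk r C.out)) fun C D hCD => ?_
  by_cases hC : s C.out p <;> by_cases hD : s D.out p
  · rw [← C.out_eq, ← D.out_eq]
    exact Quotient.sound (s.trans hC (s.symm hD))
  · simp [hC, hD] at hCD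
  · simp [hC, hD] at hCD
  · simp only [hC, hD, if_false, Option.some.injEq] at hCD
    rw [← C.out_eq, ← D.out_eq]
    refine Quotient.sound ?_
    rcases h _ _ (Quotient.exact hCD) with h | ⟨h, -⟩ | ⟨-, h⟩
    · exact h
    · exact absurd h hC
    · exact absurd (s.symm h) hD

/-- The number of orbits of a permutation. -/
noncomputable def numOrbits (f : Equiv.Perm X) : ℕ :=
  Nat.card (Quotient (Equiv.Perm.SameCycle.setoid f))

variable [DecidableEq X]

theorem numOrbits_le_mul_swap_add_one (f : Equiv.Perm X) (p q : X) :
    numOrbits f ≤ numOrbits (f * Equiv.swap p q) + 1 :=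
  card_quotient_le_succ_of_le_merge fun _ _ h => mergeSetoid_of_sameCycle_mul_swap f p q h

/-- A transposition of two points of one cycle cuts that cycle. With `n` least such that `f ^ n`
takes `p` to `q`, the new orbit of `q` stays inside `f p, …, f ^ n p = q`, which misses `p`. -/
theorem not_sameCycle_mul_swap {f : Equiv.Perm X} {p q : X} (hpq : p ≠ q)
    (h : f.SameCycle p q) : ¬ (f * Equiv.swap p q).SameCycle q p := by
  obtain ⟨i, hi⟩ := h.exists_nat_pow_eq
  classical
  have hex : ∃ n : ℕ, (f ^ n) p = q := ⟨i, hi⟩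
  set n := Nat.find hex with hn
  have hnq : (f ^ n) p = q := Nat.find_spec hex
  have hmin : ∀ m < n, (f ^ m) p ≠ q := fun m hm => Nat.find_min hex hm
  have hn0 : n ≠ 0 := by
    intro h0
    rw [h0] at hnq
    exact hpq (by simpa using hnq)
  have hp : ∀ j, 1 ≤ j → j ≤ n → (f ^ j) p ≠ p := by
    intro j hj hjn hjp
    have : (f ^ (n - j)) p = q := by
      conv_lhs => rw [← hjp]
      rw [← Equiv.Perm.mul_apply, ← pow_add, Nat.sub_add_cancel hjn, hnq]
    exact hmin _ (by omega) this
  have hclosed : ∀ m : ℕ, ∃ j, 1 ≤ j ∧ j ≤ n ∧ ((f * Equiv.swap p q) ^ m) q = (f ^ j) p := by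
    intro m
    induction m with
    | zero => exact ⟨n, by omega, le_rfl, by simpa using hnq.symm⟩
    | succ m ih =>
      obtain ⟨j, hj, hjn, he⟩ := ih
      rw [pow_succ', Equiv.Perm.mul_apply, he, Equiv.Perm.mul_apply]
      rcases hjn.eq_or_lt with rfl | hlt
      · rw [hnq, Equiv.swap_apply_right]
        exact ⟨1, le_rfl, by omega, by simp⟩
      · rw [Equiv.swap_apply_of_ne_of_ne (hp j hj hjn) (hmin j hlt)]
        exact ⟨j + 1, by omega, hlt, by rw [pow_succ', Equiv.Perm.mul_apply]⟩
  intro hc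
  obtain ⟨m, hm⟩ := hc.exists_nat_pow_eq
  obtain ⟨j, hj, hjn, he⟩ := hclosed m
  exact hp j hj hjn (he.symm.trans hm)

theorem numOrbits_lt_mul_swap {f : Equiv.Perm X} {p q : X} (hpq : p ≠ q) (h : f.SameCycle p q) :
    numOrbits f < numOrbits (f * Equiv.swap p q) :=
  card_quotient_lt_of_lt (p := p) (q := q)
    (fun _ _ hxy => rel_of_mergeSetoid h (mergeSetoid_of_sameCycle_mul_swap f p q hxy)) h
    fun h' => not_sameCycle_mul_swap hpq h h'.symm

end Setoids

section Components

variable {V : Type*} {H : SimpleGraph V} {a b : V}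

theorem mergeSetoid_of_reachable {x y : V} (h : H.Reachable x y) :
    mergeSetoid (H.deleteEdges {s(a, b)}).reachableSetoid a b x y := by
  obtain ⟨w⟩ := h
  induction w with
  | nil => exact Setoid.refl' _ _
  | @cons u v w huv _ ih =>
    refine Setoid.trans' _ ?_ ih
    by_cases he : s(u, v) = s(a, b)
    · rcases Sym2.eq_iff.1 he with ⟨rfl, rfl⟩ | ⟨rfl, rfl⟩
      · exact mergeSetoid_self _ _ _
      · exact Setoid.symm' _ (mergeSetoid_self _ _ _)
    · exact Or.inl (Adj.reachable (deleteEdges_adj.2 ⟨huv, he⟩))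

variable [Finite V]

theorem card_component_deleteEdge_le :
    Nat.card (H.deleteEdges {s(a, b)}).ConnectedComponent ≤ Nat.card H.ConnectedComponent + 1 :=
  card_quotient_le_succ_of_le_merge (s := (H.deleteEdges {s(a, b)}).reachableSetoid)
    (r := H.reachableSetoid) fun _ _ h => mergeSetoid_of_reachable h

theorem card_component_deleteEdge_le_of_reachable
    (h : (H.deleteEdges {s(a, b)}).Reachable a b) :
    Nat.card (H.deleteEdges {s(a, b)}).ConnectedComponent ≤ Nat.card H.ConnectedComponent :=
  card_quotient_le_of_le (s := (H.deleteEdges {s(a, b)}).reachableSetoid)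
    (r := H.reachableSetoid) fun _ _ h' => rel_of_mergeSetoid h (mergeSetoid_of_reachable h')

end Components

namespace RotationSystem

variable {V : Type*} {G : SimpleGraph V} (R : G.RotationSystem)

open Classical in
/-- Reversal of the darts of a subgraph `H`, fixing the other darts. -/
noncomputable def flip (H : SimpleGraph V) : Equiv.Perm G.Dart :=
  Function.Involutive.toPerm (fun d : G.Dart => if H.Adj d.fst d.snd then d.symm else d) (by
    intro d
    by_cases h : H.Adj d.fst d.snd
    · have h' : H.Adj d.symm.fst d.symm.snd := h.symm
      simp only [h, h', if_true, Dart.symm_symm]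
    · simp only [h, if_false])

theorem flip_of_adj {H : SimpleGraph V} {d : G.Dart} (h : H.Adj d.fst d.snd) :
    flip H d = d.symm := if_pos h

theorem flip_of_not_adj {H : SimpleGraph V} {d : G.Dart} (h : ¬ H.Adj d.fst d.snd) :
    flip H d = d := if_neg h

/-- The face-tracing permutation of a subgraph `H`, on all darts of `G`; the darts that are not in
`H` are passed by. -/
noncomputable def subFacePerm (H : SimpleGraph V) : Equiv.Perm G.Dart :=
  R.rot * flip H

theorem subFacePerm_of_adj {H : SimpleGraph V} {d : G.Dart} (h : H.Adj d.fst d.snd) :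
    R.subFacePerm H d = R.rot d.symm := by
  rw [subFacePerm, Equiv.Perm.mul_apply, flip_of_adj h]

theorem subFacePerm_of_not_adj {H : SimpleGraph V} {d : G.Dart} (h : ¬ H.Adj d.fst d.snd) :
    R.subFacePerm H d = R.rot d := by
  rw [subFacePerm, Equiv.Perm.mul_apply, flip_of_not_adj h]

theorem subFacePerm_self : R.subFacePerm G = R.facePerm := by
  ext1 d
  rw [R.subFacePerm_of_adj d.adj]
  rfl

/-- Deleting an edge only stops the reversal of its two darts. Keeping all darts of `G` in play thus
turns edge deletion into multiplication by a transposition on a fixed set. -/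
theorem subFacePerm_deleteEdge [DecidableEq G.Dart] {H : SimpleGraph V} (p : G.Dart)
    (hp : H.Adj p.fst p.snd) :
    R.subFacePerm (H.deleteEdges {s(p.fst, p.snd)}) = R.subFacePerm H * Equiv.swap p p.symm := by
  rw [subFacePerm, subFacePerm, mul_assoc]
  congr 1
  ext1 d
  rw [Equiv.Perm.mul_apply]
  by_cases h1 : d = p
  · subst h1
    rw [Equiv.swap_apply_left, flip_of_not_adj (by simp), flip_of_adj (by exact hp.symm),
      Dart.symm_symm]
  by_cases h2 : d = p.symm
  · subst h2
    rw [Equiv.swap_apply_right, flip_of_not_adj (by simp [Sym2.eq_swap]), flip_of_adj hp]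
  rw [Equiv.swap_apply_of_ne_of_ne h1 h2]
  have hne : s(d.fst, d.snd) ≠ s(p.fst, p.snd) := by
    intro h
    rcases (dart_edge_eq_iff d p).1 h with h | h
    exacts [h1 h, h2 h]
  by_cases h : H.Adj d.fst d.snd
  · rw [flip_of_adj h, flip_of_adj (deleteEdges_adj.2 ⟨h, hne⟩)]
  · rw [flip_of_not_adj h, flip_of_not_adj (fun h' => h (deleteEdges_adj.1 h').1)]

/-- The rest of the boundary walk through `p` leads from the head of `p` back to its tail. If the
reverse dart is not on it, this return trip avoids the edge. -/
theorem reachable_of_not_sameCycle [Finite V] {H : SimpleGraph V} (p : G.Dart)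
    (hp : H.Adj p.fst p.snd) (h : ¬ (R.subFacePerm H).SameCycle p p.symm) :
    (H.deleteEdges {s(p.fst, p.snd)}).Reachable p.fst p.snd := by
  by_contra hnr
  set f := R.subFacePerm H with hf
  have hfst : (f p).fst = p.snd := by
    rw [hf, R.subFacePerm_of_adj hp, R.rot_fst]; rfl
  have key : ∀ n : ℕ,
      (H.deleteEdges {s(p.fst, p.snd)}).Reachable p.snd ((f ^ (n + 1)) p).fst := by
    intro n
    induction n with
    | zero => rw [zero_add, pow_one, hfst]
    | succ n ih =>
      rw [pow_succ' f (n + 1), Equiv.Perm.mul_apply]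
      refine ih.trans ?_
      set x := (f ^ (n + 1)) p with hx
      have hxp : x ≠ p := fun h => hnr (by rw [h] at ih; exact ih.symm)
      have hxq : x ≠ p.symm := fun hq => h ⟨n + 1, by rw [← hq, hx]; norm_cast⟩
      by_cases hadj : H.Adj x.fst x.snd
      · rw [hf, R.subFacePerm_of_adj hadj, R.rot_fst]
        refine Adj.reachable (deleteEdges_adj.2 ⟨hadj, fun he => ?_⟩)
        rcases (dart_edge_eq_iff x p).1 he with h | h
        exacts [hxp h, hxq h]
      · rw [hf, R.subFacePerm_of_not_adj hadj, R.rot_fst]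
  have : Finite G.Dart := Finite.of_injective _ (Dart.toProd_injective (G := G))
  have h1 := key (orderOf f - 1)
  rw [Nat.sub_add_cancel (orderOf_pos f), pow_orderOf_eq_one] at h1
  exact hnr h1.symm

/-- The inequality survives each deletion. If both darts of the edge lie on one orbit, that orbit
splits while at most one component is gained; otherwise at most one orbit is lost and the edge is
not a bridge. Only vertices isolated in `G` are added: one that becomes isolated later still has an
orbit of unused darts. -/
theorem euler_deleteEdges [Finite V] (hR : R.IsGenusZero) (s : Finset (Sym2 V)) :
    Nat.card (G.deleteEdges s).edgeSet + 2 * Nat.card (G.deleteEdges s).ConnectedComponent ≤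
      Nat.card V + (numOrbits (R.subFacePerm (G.deleteEdges s)) +
        Nat.card {v : V // ∀ w, ¬ G.Adj v w}) := by
  classical
  have : Finite G.Dart := Finite.of_injective _ (Dart.toProd_injective (G := G))
  induction s using Finset.induction_on with
  | empty =>
    simp only [Finset.coe_empty, deleteEdges_empty, R.subFacePerm_self]
    exact hR.ge
  | insert e s _ ih =>
    set H := G.deleteEdges (s : Set (Sym2 V)) with hH
    have hdel : G.deleteEdges ((insert e s : Finset (Sym2 V)) : Set (Sym2 V)) =
        H.deleteEdges {e} := by
      rw [hH, deleteEdges_deleteEdges, Finset.coe_insert, Set.insert_eq, Set.union_comm]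
    rw [hdel]
    by_cases he : e ∈ H.edgeSet
    · induction e using Sym2.ind with
      | _ a b =>
        have hab : H.Adj a b := he
        let p : G.Dart := ⟨(a, b), (deleteEdges_adj.1 hab).1⟩
        have hp : H.Adj p.fst p.snd := hab
        have hperm := R.subFacePerm_deleteEdge p hp
        have hE : Nat.card (H.deleteEdges {s(a, b)}).edgeSet + 1 = Nat.card H.edgeSet := by
          rw [edgeSet_deleteEdges, Nat.card_coe_set_eq, Nat.card_coe_set_eq]
          exact Set.ncard_sdiff_singleton_add_one he
        change Nat.card (H.deleteEdges {s(a, b)}).edgeSet + 2 * _ ≤ _ +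
          (numOrbits (R.subFacePerm (H.deleteEdges {s(p.fst, p.snd)})) + _)
        rw [hperm]
        by_cases hc : (R.subFacePerm H).SameCycle p p.symm
        · have h1 := numOrbits_lt_mul_swap p.symm_ne.symm hc
          have h2 := card_component_deleteEdge_le (H := H) (a := a) (b := b)
          omega
        · have h1 := numOrbits_le_mul_swap_add_one (R.subFacePerm H) p p.symm
          have h2 := card_component_deleteEdge_le_of_reachable (H := H) (a := a) (b := b)
            (R.reachable_of_not_sameCycle p hp hc)
          omega
    · have : H.deleteEdges {e} = H := by
        rw [deleteEdges_eq_self]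
        simpa using he
      rw [this]
      exact ih

theorem euler_subgraph [Finite V] (hR : R.IsGenusZero) {H : SimpleGraph V} (hH : H ≤ G) :
    Nat.card H.edgeSet + 2 * Nat.card H.ConnectedComponent ≤
      Nat.card V + (numOrbits (R.subFacePerm H) + Nat.card {v : V // ∀ w, ¬ G.Adj v w}) := by
  have h := R.euler_deleteEdges hR (Set.toFinite (G.edgeSet \ H.edgeSet)).toFinset
  rwa [Set.Finite.coe_toFinset, deleteEdges_sdiff_eq_of_le hH] at h

end RotationSystem

end SimpleGraph

/-! ### Boundary walks of the faces of a subgraph -/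

namespace SimpleGraph

namespace RotationSystem

variable {V : Type*} {G : SimpleGraph V} (R : G.RotationSystem) (H : SimpleGraph V)

open Classical in
/-- The first dart of `H` that follows `d` in the rotation around its origin. -/
noncomputable def next (d : G.Dart) : G.Dart :=
  if h : ∃ n : ℕ, H.Adj ((R.rot ^ (n + 1)) d).fst ((R.rot ^ (n + 1)) d).snd then
    (R.rot ^ (Nat.find h + 1)) d else d

theorem rot_pow_fst (n : ℕ) (d : G.Dart) : ((R.rot ^ n) d).fst = d.fst := by
  induction n with
  | zero => rfl
  | succ n ih => rw [pow_succ', Equiv.Perm.mul_apply, R.rot_fst, ih]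

theorem next_fst (d : G.Dart) : (R.next H d).fst = d.fst := by
  unfold next
  split_ifs
  · exact R.rot_pow_fst _ _
  · rfl

variable {H}

theorem next_of_adj {d : G.Dart} (h : H.Adj (R.rot d).fst (R.rot d).snd) :
    R.next H d = R.rot d := by
  classical
  have hex : ∃ n : ℕ, H.Adj ((R.rot ^ (n + 1)) d).fst ((R.rot ^ (n + 1)) d).snd :=
    ⟨0, by simpa using h⟩
  unfold next
  rw [dif_pos hex, (Nat.find_eq_zero hex).2 (by simpa using h)]
  simp

theorem next_of_not_adj {d : G.Dart} (h : ¬ H.Adj (R.rot d).fst (R.rot d).snd)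
    (hex : ∃ n : ℕ, H.Adj ((R.rot ^ (n + 1)) d).fst ((R.rot ^ (n + 1)) d).snd) :
    R.next H d = R.next H (R.rot d) := by
  classical
  have hshift : ∀ n : ℕ, (R.rot ^ (n + 1)) d = (R.rot ^ n) (R.rot d) := fun n => by
    rw [pow_succ, Equiv.Perm.mul_apply]
  have hex' : ∃ n : ℕ, H.Adj ((R.rot ^ (n + 1)) (R.rot d)).fst
      ((R.rot ^ (n + 1)) (R.rot d)).snd := by
    obtain ⟨n, hn⟩ := hex
    rw [hshift] at hn
    cases n with
    | zero => exact absurd hn h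
    | succ n => exact ⟨n, hn⟩
  have hfind : Nat.find hex = Nat.find hex' + 1 := by
    rw [Nat.find_eq_iff]
    refine ⟨?_, fun n hn => ?_⟩
    · rw [hshift]; exact Nat.find_spec hex'
    · rw [hshift]
      cases n with
      | zero => exact h
      | succ n => exact Nat.find_min hex' (by omega)
  unfold next
  rw [dif_pos hex, dif_pos hex', hfind, hshift]

/-- The dart of `H` that follows the dart `d` of `H` along the boundary walk of a face of `H`. -/
noncomputable def faceNext (R : G.RotationSystem) (H : SimpleGraph V) (d : G.Dart) : G.Dart :=
  R.next H d.symm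

theorem faceNext_fst (d : G.Dart) : (R.faceNext H d).fst = d.snd := R.next_fst H d.symm

/-- In a boundary walk of length three, the darts form a triangle. -/
theorem faceNext_faceNext_snd {d : G.Dart}
    (h3 : R.faceNext H (R.faceNext H (R.faceNext H d)) = d) :
    (R.faceNext H (R.faceNext H d)).snd = d.fst := by
  rw [← R.faceNext_fst (H := H), h3]

theorem next_eq_faceNext_symm (d : G.Dart) : R.next H d = R.faceNext H d.symm := by
  rw [faceNext, Dart.symm_symm]

variable [Finite V]

theorem finite_dart : Finite G.Dart := Finite.of_injective _ (Dart.toProd_injective (G := G))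

theorem exists_rot_pow_adj (hH : H ≤ G) {d : G.Dart} {w : V} (h : H.Adj d.fst w) :
    ∃ n : ℕ, H.Adj ((R.rot ^ (n + 1)) d).fst ((R.rot ^ (n + 1)) d).snd := by
  have := finite_dart (G := G)
  let e : G.Dart := ⟨(d.fst, w), hH h⟩
  obtain ⟨i, hi, -, he⟩ := (R.sameCycle_of_fst_eq d e rfl).exists_pow_eq''
  refine ⟨i - 1, ?_⟩
  rw [Nat.sub_add_cancel hi, he]
  exact h

theorem next_adj (hH : H ≤ G) {d : G.Dart} {w : V} (h : H.Adj d.fst w) :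
    H.Adj (R.next H d).fst (R.next H d).snd := by
  classical
  have hex := R.exists_rot_pow_adj hH h
  unfold next
  rw [dif_pos hex]
  exact Nat.find_spec hex

theorem sameCycle_next (hH : H ≤ G) {d : G.Dart} {w : V} (h : H.Adj d.fst w) :
    (R.subFacePerm H).SameCycle (R.rot d) (R.next H d) := by
  classical
  have hex := R.exists_rot_pow_adj hH h
  have key : ∀ n ≤ Nat.find hex,
      (R.subFacePerm H).SameCycle (R.rot d) ((R.rot ^ (n + 1)) d) := by
    intro n hn
    induction n with
    | zero => rw [zero_add, pow_one]
    | succ n ih =>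
      refine (ih (by omega)).trans ?_
      have hdead := Nat.find_min hex (m := n) (by omega)
      rw [pow_succ' _ (n + 1), Equiv.Perm.mul_apply, ← R.subFacePerm_of_not_adj hdead]
      exact Equiv.Perm.sameCycle_apply_right.2 (Equiv.Perm.SameCycle.refl _ _)
  unfold next
  rw [dif_pos hex]
  exact key _ le_rfl

/-- A nonempty set of darts around a vertex that is closed under `next` contains all darts of `H`
at that vertex. -/
theorem mem_of_next_mem (hH : H ≤ G) (S : Set G.Dart) (hS : ∀ s ∈ S, R.next H s ∈ S) {s e : G.Dart}
    (hs : s ∈ S) (he : H.Adj e.fst e.snd) (hse : s.fst = e.fst) : e ∈ S := by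
  have := finite_dart (G := G)
  have key : ∀ n : ℕ, R.next H ((R.rot ^ n) s) ∈ S := by
    intro n
    induction n with
    | zero => exact hS s hs
    | succ n ih =>
      rw [pow_succ', Equiv.Perm.mul_apply]
      set x := (R.rot ^ n) s with hx
      have hxs : x.fst = e.fst := (R.rot_pow_fst n s).trans hse
      by_cases h : H.Adj (R.rot x).fst (R.rot x).snd
      · rw [R.next_of_adj h] at ih
        exact hS _ ih
      · rwa [← R.next_of_not_adj h (R.exists_rot_pow_adj hH (w := e.snd) (hxs ▸ he))]
  obtain ⟨i, hi, -, hie⟩ := (R.sameCycle_of_fst_eq s e hse).exists_pow_eq''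
  have h1 := key (i - 1)
  have h2 : R.rot ((R.rot ^ (i - 1)) s) = e := by
    rw [← Equiv.Perm.mul_apply, ← pow_succ', Nat.sub_add_cancel hi, hie]
  rwa [R.next_of_adj (by rw [h2]; exact he), h2] at h1

theorem faceNext_adj (hH : H ≤ G) {d : G.Dart} (h : H.Adj d.fst d.snd) :
    H.Adj (R.faceNext H d).fst (R.faceNext H d).snd :=
  R.next_adj hH (d := d.symm) (w := d.fst) h.symm

theorem sameCycle_faceNext (hH : H ≤ G) {d : G.Dart} (h : H.Adj d.fst d.snd) :
    (R.subFacePerm H).SameCycle d (R.faceNext H d) := by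
  refine Equiv.Perm.SameCycle.trans ?_ (R.sameCycle_next hH (d := d.symm) (w := d.fst) h.symm)
  rw [← R.subFacePerm_of_adj h]
  exact Equiv.Perm.sameCycle_apply_right.2 (Equiv.Perm.SameCycle.refl _ _)

/-- A walk turns back only when the reversed dart is its own successor under `next`, hence the sole
dart of `H` at that vertex. -/
theorem faceNext_snd_ne (hH : H ≤ G) {d : G.Dart}
    (hdeg : ∃ w, H.Adj d.snd w ∧ w ≠ d.fst) : (R.faceNext H d).snd ≠ d.fst := by
  intro he
  obtain ⟨w, hw, hwd⟩ := hdeg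
  have h1 : R.faceNext H d = d.symm := by
    refine Dart.ext _ _ (Prod.ext ?_ he)
    exact R.faceNext_fst d
  have h2 := R.mem_of_next_mem hH {d.symm} (by rintro s rfl; exact h1) (s := d.symm)
    (e := ⟨(d.snd, w), hH hw⟩) rfl hw rfl
  exact hwd (congrArg (fun x : G.Dart => x.snd) h2)

theorem exists_three_cycle (hH : H ≤ G) {d : G.Dart} (h : H.Adj d.fst d.snd)
    (h3 : R.faceNext H (R.faceNext H (R.faceNext H d)) = d) :
    ∃ c, H.Adj d.fst c ∧ H.Adj d.snd c := by
  have e1 := R.faceNext_fst (H := H) d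
  have e2 := R.faceNext_fst (H := H) (R.faceNext H d)
  have e3 := R.faceNext_faceNext_snd h3
  have h1 := R.faceNext_adj hH h
  have h2 := R.faceNext_adj hH h1
  rw [e1] at h1
  rw [e2, e3] at h2
  exact ⟨_, h2.symm, h1⟩

/-- If both darts of an edge lie on boundary walks of length three, then the ends of the edge have
degree at most two, in a graph without kites. -/
theorem eq_of_both_triangular (hH : H ≤ G) (hkite : ¬ H.HasKite) {d : G.Dart}
    (h : H.Adj d.fst d.snd) (h3 : R.faceNext H (R.faceNext H (R.faceNext H d)) = d)
    (h3' : R.faceNext H (R.faceNext H (R.faceNext H d.symm)) = d.symm) :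
    ∃ c, ∀ w, H.Adj d.snd w → w = d.fst ∨ w = c := by
  have e1 := R.faceNext_fst (H := H) d
  have e2 := R.faceNext_fst (H := H) (R.faceNext H d)
  have e3 := R.faceNext_faceNext_snd h3
  have f1 := R.faceNext_fst (H := H) d.symm
  have f2 := R.faceNext_fst (H := H) (R.faceNext H d.symm)
  have f3 := R.faceNext_faceNext_snd h3'
  have h1 := R.faceNext_adj hH h
  have h2 := R.faceNext_adj hH h1
  have k1 := R.faceNext_adj hH (d := d.symm) h.symm
  have k2 := R.faceNext_adj hH k1
  rw [e1] at h1
  rw [e2, e3] at h2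
  rw [f1] at k1
  rw [f2, f3] at k2
  have hc : (R.faceNext H d).snd = (R.faceNext H d.symm).snd := by
    by_contra hne
    exact hkite ⟨d.fst, d.snd, _, _, hne, h, h2.symm, h1, k1, k2.symm⟩
  refine ⟨(R.faceNext H d).snd, ?_⟩
  have hx : (R.faceNext H d).symm = R.faceNext H (R.faceNext H d.symm) := by
    refine Dart.ext _ _ (Prod.ext ?_ ?_)
    · rw [f2, ← hc]; rfl
    · rw [f3]; exact e1
  intro w hw
  -- The two triangles coincide, so these two darts follow each other in the rotation and are all
  -- the darts of `H` at `d.snd`.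
  have hmem := R.mem_of_next_mem hH {d.symm, R.faceNext H d} (by
    rintro s (rfl | rfl)
    · exact Or.inr rfl
    · left
      rw [R.next_eq_faceNext_symm, hx, h3']) (s := d.symm) (e := ⟨(d.snd, w), hH hw⟩) (Or.inl rfl) hw rfl
  rcases hmem with hm | hm
  · exact Or.inl (congrArg (fun x : G.Dart => x.snd) hm)
  · exact Or.inr (congrArg (fun x : G.Dart => x.snd) hm)

/-- Minimum degree two on the edges forbids turning back, so four consecutive darts are distinct
unless the walk closes after three. -/
theorem four_distinct_or_triangular (hH : H ≤ G)
    (hdeg : ∀ v w, H.Adj v w → ∃ x, H.Adj v x ∧ x ≠ w) {d : G.Dart} (h : H.Adj d.fst d.snd) :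
    ∃ s : Finset G.Dart, (∀ e ∈ s, H.Adj e.fst e.snd ∧ (R.subFacePerm H).SameCycle d e) ∧
      (s.card = 4 ∨ s.card = 3 ∧
        ∀ e ∈ s, R.faceNext H (R.faceNext H (R.faceNext H e)) = e) := by
  classical
  set d1 := R.faceNext H d with hd1
  set d2 := R.faceNext H d1 with hd2
  set d3 := R.faceNext H d2 with hd3
  have e1 : d1.fst = d.snd := R.faceNext_fst _
  have e2 : d2.fst = d1.snd := R.faceNext_fst _
  have e3 : d3.fst = d2.snd := R.faceNext_fst _
  have h1 := R.faceNext_adj hH h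
  have h2 := R.faceNext_adj hH h1
  have h3 := R.faceNext_adj hH h2
  have c1 := R.sameCycle_faceNext hH h
  have c2 := c1.trans (R.sameCycle_faceNext hH h1)
  have c3 := c2.trans (R.sameCycle_faceNext hH h2)
  have n1 : d1.snd ≠ d.fst := R.faceNext_snd_ne hH (hdeg _ _ h.symm)
  have n2 : d2.snd ≠ d1.fst := R.faceNext_snd_ne hH (hdeg _ _ h1.symm)
  have a1 : d.fst ≠ d1.fst := e1 ▸ d.fst_ne_snd
  have a2 : d1.fst ≠ d2.fst := e2 ▸ d1.fst_ne_snd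
  have a3 : d2.fst ≠ d3.fst := e3 ▸ d2.fst_ne_snd
  have b01 : d ≠ d1 := fun he => a1 (congrArg (fun x : G.Dart => x.fst) he)
  have b12 : d1 ≠ d2 := fun he => a2 (congrArg (fun x : G.Dart => x.fst) he)
  have b23 : d2 ≠ d3 := fun he => a3 (congrArg (fun x : G.Dart => x.fst) he)
  have b02 : d ≠ d2 := fun he => n1 (by
    rw [← e2]; exact (congrArg (fun x : G.Dart => x.fst) he).symm)
  have b13 : d1 ≠ d3 := fun he => n2 (by
    rw [← e3]; exact (congrArg (fun x : G.Dart => x.fst) he).symm)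
  by_cases h03 : d3 = d
  · refine ⟨{d, d1, d2}, ?_, Or.inr ⟨Finset.card_eq_three.2 ⟨d, d1, d2, b01, b02, b12, rfl⟩, ?_⟩⟩
    · intro e he
      simp only [Finset.mem_insert, Finset.mem_singleton] at he
      rcases he with rfl | rfl | rfl
      exacts [⟨h, Equiv.Perm.SameCycle.refl _ _⟩, ⟨h1, c1⟩, ⟨h2, c2⟩]
    · intro e he
      simp only [Finset.mem_insert, Finset.mem_singleton] at he
      rcases he with rfl | rfl | rfl
      · exact h03
      · rw [← hd2, ← hd3, h03]
      · rw [← hd3, h03, ← hd1]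
  · refine ⟨{d, d1, d2, d3}, ?_, Or.inl ?_⟩
    · intro e he
      simp only [Finset.mem_insert, Finset.mem_singleton] at he
      rcases he with rfl | rfl | rfl | rfl
      exacts [⟨h, Equiv.Perm.SameCycle.refl _ _⟩, ⟨h1, c1⟩, ⟨h2, c2⟩, ⟨h3, c3⟩]
    · have h30 : d ≠ d3 := fun he => h03 he.symm
      rw [Finset.card_insert_of_notMem (by simp [b01, b02, h30]),
        Finset.card_insert_of_notMem (by simp [b12, b13]), Finset.card_pair b23]

end RotationSystem

end SimpleGraph

/-! ### Counting faces by their lengths -/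

namespace SimpleGraph

open Finset

section Counting

variable {V : Type*} [Fintype V] {G : SimpleGraph V}

open Classical in
theorem card_filter_dart (P : V → V → Prop) (hP : ∀ a b, P a b → G.Adj a b) :
    #{d : G.Dart | P d.fst d.snd} = ∑ v, #{b | P v b} := by
  rw [Finset.card_eq_sum_card_fiberwise (f := fun d : G.Dart => d.fst) (t := Finset.univ)
    (fun _ _ => Finset.mem_coe.2 (Finset.mem_univ _))]
  refine Finset.sum_congr rfl fun v _ => ?_
  refine Finset.card_bij (fun d _ => d.snd) ?_ ?_ ?_
  · intro d hd
    simp only [mem_filter, mem_univ, true_and] at hd ⊢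
    exact hd.2 ▸ hd.1
  · intro d hd e he hde
    simp only [mem_filter, mem_univ, true_and] at hd he
    exact Dart.ext _ _ (Prod.ext (hd.2.trans he.2.symm) hde)
  · intro b hb
    simp only [mem_filter, mem_univ, true_and] at hb
    exact ⟨⟨(v, b), hP _ _ hb⟩, by simpa using hb, rfl⟩

open Classical in
theorem card_filter_adj_dart {H : SimpleGraph V} (hH : H ≤ G) :
    #{d : G.Dart | H.Adj d.fst d.snd} = 2 * Nat.card H.edgeSet := by
  rw [card_filter_dart _ fun a b h => hH h, Nat.card_eq_fintype_card, ← edgeFinset_card,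
    ← sum_degrees_eq_twice_card_edges]
  refine Finset.sum_congr rfl fun v _ => ?_
  rw [← card_neighborFinset_eq_degree]
  congr 1
  ext w
  simp

/-- The neighbours `b` of `v` such that the edge `v b` lies in a triangle. -/
noncomputable def triangleNeighbors (H : SimpleGraph V) (v : V) : Finset V :=
  open Classical in {b | H.Adj v b ∧ ∃ c, H.Adj v c ∧ H.Adj b c}

theorem mem_triangleNeighbors {H : SimpleGraph V} {v b : V} :
    b ∈ H.triangleNeighbors v ↔ H.Adj v b ∧ ∃ c, H.Adj v c ∧ H.Adj b c := by
  simp [triangleNeighbors]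

end Counting

namespace RotationSystem

variable {V : Type*} [Fintype V] {G : SimpleGraph V} (R : G.RotationSystem) {H : SimpleGraph V}

-- The reverse of a triangular dart is not triangular, since otherwise both ends of the edge would
-- have degree at most two. Yet both darts lie on an edge of a triangle, so each triangular dart
-- accounts for two of the pairs counted on the right.
open Classical in
theorem card_triangular_le (hH : H ≤ G) (hkite : ¬ H.HasKite)
    (hdeg2 : ∀ u v, H.Adj u v → 4 < H.degree u + H.degree v) :
    2 * #{d : G.Dart | H.Adj d.fst d.snd ∧
      R.faceNext H (R.faceNext H (R.faceNext H d)) = d} ≤ ∑ v, #(H.triangleNeighbors v) := by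
  have hT : ∑ v, #(H.triangleNeighbors v) = #{d : G.Dart | H.Adj d.fst d.snd ∧
      ∃ c, H.Adj d.fst c ∧ H.Adj d.snd c} := by
    refine Eq.trans ?_ ((card_filter_dart (fun a b => H.Adj a b ∧ ∃ c, H.Adj a c ∧ H.Adj b c)
      (fun a b h => hH h.1)).symm.trans (by congr))
    refine Finset.sum_congr rfl fun v _ => ?_
    congr 1
    ext b
    simp [mem_triangleNeighbors]
  set T : Finset G.Dart := {d : G.Dart | H.Adj d.fst d.snd ∧
      R.faceNext H (R.faceNext H (R.faceNext H d)) = d} with hTdef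
  have hmem : ∀ d, d ∈ T ↔ H.Adj d.fst d.snd ∧
      R.faceNext H (R.faceNext H (R.faceNext H d)) = d := fun d => by simp [hTdef]
  have hdegle : ∀ u v c, (∀ w, H.Adj u w → w = v ∨ w = c) → H.degree u ≤ 2 := by
    intro u v c h
    rw [← card_neighborFinset_eq_degree]
    refine (Finset.card_le_card (t := {v, c}) fun w hw => ?_).trans Finset.card_le_two
    simpa using h w (by simpa using hw)
  have hdisj : Disjoint T (T.image Dart.symm) := by
    rw [Finset.disjoint_left]
    intro d hd hd'
    obtain ⟨e, he, rfl⟩ := Finset.mem_image.1 hd'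
    obtain ⟨h1, h2⟩ := (hmem _).1 he
    obtain ⟨h3, h4⟩ := (hmem _).1 hd
    obtain ⟨c, hc⟩ := R.eq_of_both_triangular hH hkite h1 h2 h4
    obtain ⟨c', hc'⟩ := R.eq_of_both_triangular hH hkite (d := e.symm) h3 h4
      (by rwa [Dart.symm_symm])
    have k1 := hdegle e.snd e.fst c hc
    have k2 := hdegle e.fst e.snd c' hc'
    have := hdeg2 _ _ h1
    omega
  rw [hT, two_mul]
  nth_rw 2 [← Finset.card_image_of_injective T (Dart.symm_involutive (G := G)).injective]
  rw [← Finset.card_union_of_disjoint hdisj]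
  refine Finset.card_le_card fun d hd => ?_
  rw [Finset.mem_filter]
  refine ⟨Finset.mem_univ _, ?_⟩
  rcases Finset.mem_union.1 hd with hd | hd
  · obtain ⟨h1, h2⟩ := (hmem _).1 hd
    exact ⟨h1, R.exists_three_cycle hH h1 h2⟩
  · obtain ⟨e, he, rfl⟩ := Finset.mem_image.1 hd
    obtain ⟨h1, h2⟩ := (hmem _).1 he
    obtain ⟨c, h3, h4⟩ := R.exists_three_cycle hH h1 h2
    exact ⟨h1.symm, c, h4, h3⟩

/-- Each orbit meeting `H` collects weight 24 from its darts in `H`, and the total weight is at most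
`12 |E(H)| + ∑ t(v)`. The remaining orbits belong to vertices that are isolated in `H` but not in
`G`. -/
theorem numOrbits_le (hH : H ≤ G) (hkite : ¬ H.HasKite)
    (hdeg : ∀ v w, H.Adj v w → ∃ x, H.Adj v x ∧ x ≠ w)
    (hdeg2 : ∀ u v, H.Adj u v → 4 < Nat.card (H.neighborSet u) + Nat.card (H.neighborSet v)) :
    24 * (numOrbits (R.subFacePerm H) + Nat.card {v : V // ∀ w, ¬ G.Adj v w}) ≤
      24 * Nat.card {v : V // ∀ w, ¬ H.Adj v w} + 12 * Nat.card H.edgeSet +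
        ∑ v, #(H.triangleNeighbors v) := by
  classical
  let Q := Quotient (Equiv.Perm.SameCycle.setoid (R.subFacePerm H))
  let q : G.Dart → Q := Quotient.mk _
  have hq : ∀ d e, q d = q e ↔ (R.subFacePerm H).SameCycle d e := fun d e =>
    ⟨fun h => Quotient.exact h, fun h => Quotient.sound h⟩
  let live : Finset G.Dart := {d : G.Dart | H.Adj d.fst d.snd}
  let tri : Finset G.Dart := {d : G.Dart | H.Adj d.fst d.snd ∧
      R.faceNext H (R.faceNext H (R.faceNext H d)) = d}
  have htri := R.card_triangular_le hH hkite (by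
    intro u v huv
    have := hdeg2 u v huv
    simpa only [Nat.card_eq_fintype_card, card_neighborSet_eq_degree] using this)
  have hlive := card_filter_adj_dart (G := G) hH
  -- Weight 6 per dart gives 24 from four darts; weight 8 per triangular dart gives 24 from three.
  let w : G.Dart → ℕ := fun d => 6 + if d ∈ tri then 2 else 0
  have hsum : ∑ d ∈ live, w d = 6 * #live + 2 * #tri := by
    have hsub : live.filter (fun d => d ∈ tri) = tri := by
      ext d
      simp only [live, tri, mem_filter, mem_univ, true_and]
      tauto
    rw [Finset.sum_add_distrib, Finset.sum_const, smul_eq_mul, ← Finset.sum_filter, hsub,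
      Finset.sum_const, smul_eq_mul]
    ring
  have hface : 24 * #(live.image q) ≤ ∑ d ∈ live, w d := by
    rw [← Finset.sum_fiberwise_of_maps_to (t := live.image q) (g := q)
      (fun d hd => Finset.mem_image_of_mem q hd), mul_comm, ← smul_eq_mul]
    refine Finset.card_nsmul_le_sum _ _ _ fun x hx => ?_
    obtain ⟨d, hd, rfl⟩ := Finset.mem_image.1 hx
    obtain ⟨s, hs, hcard⟩ := R.four_distinct_or_triangular hH hdeg (Finset.mem_filter.1 hd).2
    have hss : s ⊆ live.filter (fun e => q e = q d) := by
      intro e he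
      refine Finset.mem_filter.2 ⟨Finset.mem_filter.2 ⟨Finset.mem_univ _, (hs e he).1⟩, ?_⟩
      exact ((hq _ _).2 (hs e he).2).symm
    refine le_trans ?_ (Finset.sum_le_sum_of_subset hss)
    rcases hcard with hc | ⟨hc, h3⟩
    · calc 24 = #s • 6 := by rw [hc]; rfl
        _ ≤ _ := Finset.card_nsmul_le_sum _ _ _ fun e _ => Nat.le_add_right _ _
    · calc 24 = #s • 8 := by rw [hc]; rfl
        _ ≤ _ := Finset.card_nsmul_le_sum _ _ _ fun e he => by
          have : e ∈ tri := Finset.mem_filter.2 ⟨Finset.mem_univ _, (hs e he).1, h3 e he⟩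
          simp only [w, this, if_true, le_refl]
  have hdead : numOrbits (R.subFacePerm H) + Nat.card {v : V // ∀ w, ¬ G.Adj v w} ≤
      #(live.image q) + Nat.card {v : V // ∀ w, ¬ H.Adj v w} := by
    have hcast : #(live.image q) = Nat.card (live.image q) := by
      rw [Nat.card_eq_fintype_card, Fintype.card_coe]
    have : Finite Q := Quotient.finite _
    rw [hcast, numOrbits, ← Nat.card_sum, ← Nat.card_sum]
    have hno : ∀ x : Q, x ∉ live.image q → ∀ d, q d = x → ∀ w, ¬ H.Adj d.fst w := by
      intro x hx d hd w hw
      refine hx (Finset.mem_image.2 ?_)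
      have hdd : ¬ H.Adj d.fst d.snd := fun h => hx (Finset.mem_image.2
        ⟨d, Finset.mem_filter.2 ⟨Finset.mem_univ _, h⟩, hd⟩)
      refine ⟨R.next H d, Finset.mem_filter.2 ⟨Finset.mem_univ _, R.next_adj hH hw⟩, ?_⟩
      rw [← hd, hq]
      refine Equiv.Perm.SameCycle.symm (Equiv.Perm.SameCycle.trans ?_ (R.sameCycle_next hH hw))
      rw [← R.subFacePerm_of_not_adj hdd]
      exact Equiv.Perm.sameCycle_apply_right.2 (Equiv.Perm.SameCycle.refl _ _)
    have hout : ∀ x : Q, q x.out = x := fun x => x.out_eq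
    -- An orbit without darts of `H` is charged to the origin of its darts. That vertex determines
    -- it, because `subFacePerm` is the plain rotation there.
    let F : Q ⊕ {v : V // ∀ w, ¬ G.Adj v w} → live.image q ⊕ {v : V // ∀ w, ¬ H.Adj v w} :=
      Sum.elim
        (fun x => if hx : x ∈ live.image q then Sum.inl ⟨x, hx⟩ else
          Sum.inr ⟨x.out.fst, hno x hx _ (hout x)⟩)
        (fun v => Sum.inr ⟨v.1, fun w h => v.2 w (hH h)⟩)
    have hFl : ∀ x (hx : x ∈ live.image q), F (Sum.inl x) = Sum.inl ⟨x, hx⟩ := fun x hx => dif_pos hx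
    have hFr : ∀ x (hx : x ∉ live.image q), F (Sum.inl x) = Sum.inr ⟨x.out.fst, hno x hx _ (hout x)⟩ :=
      fun x hx => dif_neg hx
    refine Nat.card_le_card_of_injective F ?_
    rintro (x | x) (y | y) hxy
    · by_cases hx : x ∈ live.image q <;> by_cases hy : y ∈ live.image q
      · rw [hFl x hx, hFl y hy, Sum.inl.injEq, Subtype.mk.injEq] at hxy
        rw [hxy]
      · rw [hFl x hx, hFr y hy] at hxy
        exact absurd hxy Sum.inl_ne_inr
      · rw [hFr x hx, hFl y hy] at hxy
        exact absurd hxy Sum.inr_ne_inl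
      · rw [hFr x hx, hFr y hy, Sum.inr.injEq, Subtype.mk.injEq] at hxy
        congr 1
        rw [← hout x, ← hout y, hq]
        have hiso := hno x hx _ (hout x)
        have key : ∀ n : ℕ, (R.subFacePerm H).SameCycle x.out ((R.rot ^ n) x.out) := by
          intro n
          induction n with
          | zero => exact Equiv.Perm.SameCycle.refl _ _
          | succ n ih =>
            refine ih.trans ?_
            rw [pow_succ', Equiv.Perm.mul_apply, ← R.subFacePerm_of_not_adj (H := H)
              (fun h => hiso _ (by rwa [R.rot_pow_fst] at h))]
            exact Equiv.Perm.sameCycle_apply_right.2 (Equiv.Perm.SameCycle.refl _ _)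
        obtain ⟨n, hn⟩ := (R.sameCycle_of_fst_eq _ _ hxy).exists_nat_pow_eq
        rw [← hn]
        exact key n
    · by_cases hx : x ∈ live.image q
      · rw [hFl x hx] at hxy
        exact absurd hxy Sum.inl_ne_inr
      · rw [hFr x hx] at hxy
        have : x.out.fst = y.1 := Subtype.ext_iff.1 (Sum.inr_injective hxy)
        exact absurd (this ▸ x.out.adj) (y.2 _)
    · by_cases hy : y ∈ live.image q
      · rw [hFl y hy] at hxy
        exact absurd hxy Sum.inr_ne_inl
      · rw [hFr y hy] at hxy
        have : x.1 = y.out.fst := Subtype.ext_iff.1 (Sum.inr_injective hxy)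
        exact absurd (this ▸ y.out.adj) (x.2 _)
    · simp only [F, Sum.elim_inr, Sum.inr.injEq, Subtype.mk.injEq] at hxy
      rw [Subtype.ext hxy]
  have hlive' : #live = 2 * Nat.card H.edgeSet := hlive
  have htri' : 2 * #tri ≤ ∑ v, #(H.triangleNeighbors v) := htri
  omega

end RotationSystem

/-- Euler's formula for subgraphs of a planar graph without kites, with faces counted by their
lengths. -/
theorem IsPlanar.euler_triangles {V : Type*} [Fintype V] {G H : SimpleGraph V} (hG : G.IsPlanar)
    (hH : H ≤ G) (hkite : ¬ H.HasKite) (hdeg : ∀ v w, H.Adj v w → ∃ x, H.Adj v x ∧ x ≠ w)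
    (hdeg2 : ∀ u v, H.Adj u v → 4 < Nat.card (H.neighborSet u) + Nat.card (H.neighborSet v)) :
    12 * Nat.card H.edgeSet + 48 * Nat.card H.ConnectedComponent ≤
      24 * Nat.card V + 24 * Nat.card {v : V // ∀ w, ¬ H.Adj v w} +
        ∑ v, #(H.triangleNeighbors v) := by
  obtain ⟨R, hR⟩ := hG
  have h1 := R.euler_subgraph hR hH
  have h2 := R.numOrbits_le hH hkite hdeg hdeg2
  omega

end SimpleGraph

/-! ### Triangles, low degrees and discharging -/

namespace SimpleGraph

open Finset

section Discharging

variable {V : Type*} [Fintype V] {H : SimpleGraph V}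

/-- In a graph without kites, the edge joining `v` to one of its triangle neighbours lies in a
unique triangle. -/
theorem exists_third_vertex (hkite : ¬ H.HasKite) : ∃ third : V → V → V,
    (∀ v b, b ∈ H.triangleNeighbors v → H.Adj v b ∧ H.Adj v (third v b) ∧ H.Adj b (third v b)) ∧
      ∀ v b c, H.Adj v b → H.Adj v c → H.Adj b c → third v b = c := by
  have hex : ∀ v b, ∃ c, b ∈ H.triangleNeighbors v → H.Adj v b ∧ H.Adj v c ∧ H.Adj b c := by
    intro v b
    by_cases h : b ∈ H.triangleNeighbors v
    · obtain ⟨h1, c, h2, h3⟩ := mem_triangleNeighbors.1 h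
      exact ⟨c, fun _ => ⟨h1, h2, h3⟩⟩
    · exact ⟨v, fun h' => absurd h' h⟩
  choose third hthird using hex
  refine ⟨third, hthird, fun v b c h1 h2 h3 => ?_⟩
  obtain ⟨-, h4, h5⟩ := hthird v b (mem_triangleNeighbors.2 ⟨h1, c, h2, h3⟩)
  by_contra hne
  exact hkite ⟨v, b, _, _, hne, h1, h4, h5, h2, h3⟩

/-- Each triangle at `v` pairs two neighbours, and without kites these pairs are disjoint: `third v`
is an involution without fixed points. -/
theorem even_card_triangleNeighbors (hkite : ¬ H.HasKite) (v : V) :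
    Even #(H.triangleNeighbors v) := by
  obtain ⟨third, h1, h2⟩ := exists_third_vertex hkite
  have : ∑ _b ∈ H.triangleNeighbors v, (1 : ZMod 2) = 0 := by
    refine Finset.sum_involution (fun b _ => third v b) ?_ ?_ ?_ ?_
    · intro _ _; decide
    · intro b hb _ he
      obtain ⟨-, -, h⟩ := h1 v b hb
      rw [he] at h
      exact h.ne rfl
    · intro b hb
      obtain ⟨h3, h4, h5⟩ := h1 v b hb
      exact mem_triangleNeighbors.2 ⟨h4, b, h3, h5.symm⟩
    · intro b hb
      obtain ⟨h3, h4, h5⟩ := h1 v b hb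
      exact h2 v _ b h4 h3 h5.symm
  rw [Finset.sum_const, nsmul_eq_mul, mul_one] at this
  exact (ZMod.natCast_eq_zero_iff_even).1 this

/-- Isolated vertices are components of their own, and the edge `uv` supplies one more. This strict
inequality is the slack that finally yields the contradiction. -/
theorem card_isolated_lt_card_component {u v : V} (huv : H.Adj u v) :
    Nat.card {v : V // ∀ w, ¬ H.Adj v w} < Nat.card H.ConnectedComponent := by
  have hiso : ∀ x y, (∀ w, ¬ H.Adj x w) → H.Reachable x y → x = y := by
    rintro x y hx ⟨p⟩
    cases p with
    | nil => rfl
    | cons h _ => exact absurd h (hx _)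
  have : Finite H.ConnectedComponent := Quot.finite _
  rw [← Nat.succ_le_iff, Nat.succ_eq_add_one, ← Finite.card_option]
  refine Nat.card_le_card_of_injective (fun o : Option {v : V // ∀ w, ¬ H.Adj v w} =>
    o.elim (H.connectedComponentMk u) fun x => H.connectedComponentMk x.1) ?_
  rintro (_ | x) (_ | y) hxy
  · rfl
  · have := hiso y.1 u y.2 (ConnectedComponent.exact hxy).symm
    exact absurd huv (this ▸ y.2 v)
  · have := hiso x.1 u x.2 (ConnectedComponent.exact hxy)
    exact absurd huv (this ▸ x.2 v)
  · rw [Subtype.ext (hiso x.1 y.1 x.2 (ConnectedComponent.exact hxy))]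

variable [DecidableRel H.Adj]

theorem card_triangleNeighbors_le_degree (v : V) : #(H.triangleNeighbors v) ≤ H.degree v := by
  rw [← card_neighborFinset_eq_degree]
  exact Finset.card_le_card fun b hb => by
    rw [mem_neighborFinset]
    exact (mem_triangleNeighbors.1 hb).1

/-- The number of neighbours of degree at most three. -/
noncomputable def lowDegree (H : SimpleGraph V) [DecidableRel H.Adj] (v : V) : ℕ :=
  #{b ∈ H.neighborFinset v | H.degree b ≤ 3}

/-- Low vertices are never adjacent, so in each triangle at `v` at most one of the two other
vertices is low. Hence at least half of the triangle neighbours are not low. -/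
theorem two_mul_lowDegree_le (hkite : ¬ H.HasKite)
    (hlow : ∀ u v, H.Adj u v → H.degree u ≤ 4 → 4 < H.degree v) (v : V) :
    2 * H.lowDegree v + #(H.triangleNeighbors v) ≤ 2 * H.degree v := by
  classical
  obtain ⟨third, h1, h2⟩ := exists_third_vertex hkite
  set N := H.neighborFinset v
  set T := H.triangleNeighbors v
  have hTN : T ⊆ N := fun b hb => by
    rw [mem_neighborFinset]
    exact (mem_triangleNeighbors.1 hb).1
  have hTlow : #{b ∈ T | H.degree b ≤ 3} ≤ #{b ∈ T | ¬ H.degree b ≤ 3} := by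
    refine Finset.card_le_card_of_injOn (third v) ?_ ?_
    · intro b hb
      obtain ⟨hbT, hb3⟩ := Finset.mem_filter.1 (Finset.mem_coe.1 hb)
      obtain ⟨h3, h4, h5⟩ := h1 v b hbT
      have := hlow b _ h5 (by omega)
      exact Finset.mem_coe.2 (Finset.mem_filter.2
        ⟨mem_triangleNeighbors.2 ⟨h4, b, h3, h5.symm⟩, by omega⟩)
    · intro b hb c hc hbc
      obtain ⟨hbT, -⟩ := Finset.mem_filter.1 (Finset.mem_coe.1 hb)
      obtain ⟨hcT, -⟩ := Finset.mem_filter.1 (Finset.mem_coe.1 hc)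
      obtain ⟨h3, h4, h5⟩ := h1 v b hbT
      obtain ⟨h6, h7, h8⟩ := h1 v c hcT
      rw [← h2 v _ b h4 h3 h5.symm, hbc]
      exact h2 v _ c h7 h6 h8.symm
  have e1 := Finset.card_filter_add_card_filter_not (s := T) (fun b => H.degree b ≤ 3)
  have e2 := Finset.card_filter_add_card_filter_not (s := N) (fun b => H.degree b ≤ 3)
  have e3 : #{b ∈ T | ¬ H.degree b ≤ 3} ≤ #{b ∈ N | ¬ H.degree b ≤ 3} :=
    Finset.card_le_card (Finset.filter_subset_filter _ hTN)
  have e4 : #N = H.degree v := H.card_neighborFinset_eq_degree v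
  have e5 : H.lowDegree v = #{b ∈ N | H.degree b ≤ 3} := rfl
  omega

/-- Each triangle has at most one vertex of degree at most four. -/
theorem two_mul_sum_card_triangleNeighbors_le (hkite : ¬ H.HasKite)
    (hlow : ∀ u v, H.Adj u v → H.degree u ≤ 4 → 4 < H.degree v) :
    2 * ∑ v with H.degree v ≤ 4, #(H.triangleNeighbors v) ≤
      ∑ v with ¬ H.degree v ≤ 4, #(H.triangleNeighbors v) := by
  classical
  obtain ⟨third, h1, h2⟩ := exists_third_vertex hkite
  simp only [← Finset.card_sigma]
  set A : Finset (Σ _ : V, V) := Finset.sigma {v | H.degree v ≤ 4} fun v => H.triangleNeighbors v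
  set B : Finset (Σ _ : V, V) := Finset.sigma {v | ¬ H.degree v ≤ 4} fun v => H.triangleNeighbors v
  -- From a low vertex `v` and a triangle neighbour `b`, `f` and `g` give the two pairs of that
  -- triangle starting at `b`. The second entry is low for `f` and not for `g`, so the images are
  -- disjoint.
  let f : (Σ _ : V, V) → (Σ _ : V, V) := fun x => ⟨x.2, x.1⟩
  let g : (Σ _ : V, V) → (Σ _ : V, V) := fun x => ⟨x.2, third x.1 x.2⟩
  have hA : ∀ x, x ∈ A ↔ H.degree x.1 ≤ 4 ∧ x.2 ∈ H.triangleNeighbors x.1 := fun x => by simp [A]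
  have hB : ∀ x, x ∈ B ↔ ¬ H.degree x.1 ≤ 4 ∧ x.2 ∈ H.triangleNeighbors x.1 := fun x => by simp [B]
  have hf : Set.InjOn f A := by
    rintro ⟨a, b⟩ _ ⟨c, d⟩ _ h
    simp only [f, Sigma.mk.injEq, heq_eq_eq] at h ⊢
    exact ⟨h.2, h.1⟩
  have hg : Set.InjOn g A := by
    rintro ⟨a, b⟩ hx ⟨c, d⟩ hy h
    simp only [g, Sigma.mk.injEq, heq_eq_eq] at h ⊢
    obtain ⟨rfl, h⟩ := h
    obtain ⟨h3, h4, h5⟩ := h1 a b ((hA _).1 hx).2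
    obtain ⟨h6, h7, h8⟩ := h1 c b ((hA _).1 hy).2
    refine ⟨?_, rfl⟩
    rw [← h2 b _ a h5 h3.symm h4.symm, h]
    exact h2 b _ c h8 h6.symm h7.symm
  have hdisj : Disjoint (A.image f) (A.image g) := by
    rw [Finset.disjoint_left]
    intro x hx hx'
    obtain ⟨y, hy, rfl⟩ := Finset.mem_image.1 hx
    obtain ⟨z, hz, hzy⟩ := Finset.mem_image.1 hx'
    simp only [f, g, Sigma.mk.injEq, heq_eq_eq] at hzy
    obtain ⟨h3, h4, h5⟩ := h1 _ _ ((hA z).1 hz).2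
    have := hlow _ _ h4 ((hA z).1 hz).1
    have := ((hA y).1 hy).1
    rw [← hzy.2] at this
    omega
  have hsub : A.image f ∪ A.image g ⊆ B := by
    intro x hx
    rcases Finset.mem_union.1 hx with hx | hx
    · obtain ⟨y, hy, rfl⟩ := Finset.mem_image.1 hx
      obtain ⟨h3, h4, h5⟩ := h1 _ _ ((hA y).1 hy).2
      have := hlow _ _ h3 ((hA y).1 hy).1
      exact (hB _).2 ⟨by simpa [f] using this, mem_triangleNeighbors.2 ⟨h3.symm, _, h5, h4⟩⟩
    · obtain ⟨y, hy, rfl⟩ := Finset.mem_image.1 hx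
      obtain ⟨h3, h4, h5⟩ := h1 _ _ ((hA y).1 hy).2
      have := hlow _ _ h3 ((hA y).1 hy).1
      exact (hB _).2 ⟨by simpa [g] using this, mem_triangleNeighbors.2 ⟨h5, _, h3.symm, h4.symm⟩⟩
  have := Finset.card_le_card hsub
  rw [Finset.card_union_of_disjoint hdisj, Finset.card_image_of_injOn hf,
    Finset.card_image_of_injOn hg] at this
  omega

theorem sum_lowDegree : ∑ v, H.lowDegree v = ∑ v with H.degree v ≤ 3, H.degree v := by
  have := Finset.sum_card_bipartiteAbove_eq_sum_card_bipartiteBelow (s := Finset.univ)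
    (t := Finset.univ.filter fun v => H.degree v ≤ 3) (fun u v => H.Adj u v)
  rw [Finset.sum_congr rfl fun v _ => (?_ : H.lowDegree v = _), this]
  · refine Finset.sum_congr rfl fun v _ => ?_
    rw [← card_neighborFinset_eq_degree]
    congr 1
    ext w
    simp [Finset.bipartiteBelow, adj_comm]
  · unfold lowDegree
    congr 1
    ext w
    simp [Finset.bipartiteAbove, and_comm]

/-- The discharging argument: vertices of degree `k` pay for the vertices of degree two, vertices of
degree at least eight for their neighbours of degree three, and vertices of degree at least five for
their triangles. -/
theorem no_light_edge_contradiction {k : ℕ} (hk : 9 ≤ k) (hkite : ¬ H.HasKite)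
    (hdeg : ∀ v, H.degree v ≤ k)
    (hedge : ∀ u v, H.Adj u v → H.degree u ≤ 4 → k + 2 ≤ H.degree u + H.degree v)
    (h2k : #{v | H.degree v = 2} ≤ #{v | H.degree v = k}) {u₀ v₀ : V} (h₀ : H.Adj u₀ v₀)
    (heuler : 12 * Nat.card H.edgeSet + 48 * Nat.card H.ConnectedComponent ≤
      24 * Nat.card V + 24 * Nat.card {v : V // ∀ w, ¬ H.Adj v w} +
        ∑ v, #(H.triangleNeighbors v)) : False := by
  classical
  have hlow : ∀ u v, H.Adj u v → H.degree u ≤ 4 → 4 < H.degree v := fun u v huv hu => by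
    have := hedge u v huv hu
    omega
  have hcomp := card_isolated_lt_card_component h₀
  have hiso : Nat.card {v : V // ∀ w, ¬ H.Adj v w} = #{v | H.degree v = 0} := by
    rw [Nat.card_eq_fintype_card, Fintype.card_subtype]
    congr 1
    ext v
    have := H.degree_pos_iff_exists_adj v
    simp only [mem_filter, mem_univ, true_and]
    rw [← not_iff_not, not_forall_not, ← this]
    omega
  have hE : 2 * Nat.card H.edgeSet = ∑ v, H.degree v := by
    rw [sum_degrees_eq_twice_card_edges, Nat.card_eq_fintype_card, ← edgeFinset_card]
  have htri := two_mul_sum_card_triangleNeighbors_le hkite hlow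
  have hsplit := Finset.sum_filter_add_sum_filter_not Finset.univ (fun v => H.degree v ≤ 4)
    (fun v => #(H.triangleNeighbors v))
  have hlowsum := sum_lowDegree (H := H)
  -- With charge `12 deg - 48`, each edge at a vertex of degree at most 3 brings it 4, and a vertex
  -- of degree 2 receives 16 more, matched by 16 from a vertex of degree `k`. Vertices of degree at
  -- least 5 pay `3 t(v)`, which covers `2 t` over all vertices because each triangle has at most
  -- one vertex of degree at most 4. Evenness of `t(v)` is needed: the bound is tight at degree 5
  -- and at `k = 9`.
  have hpt : ∀ v, (48 + 4 * H.lowDegree v + (if ¬ H.degree v ≤ 4 then 3 * #(H.triangleNeighbors v)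
      else 0) + if H.degree v = k then 16 else 0) ≤ 12 * H.degree v +
      (if H.degree v = 0 then 48 else 0) + (if H.degree v ≤ 3 then 4 * H.degree v else 0) +
      if H.degree v = 2 then 16 else 0 := by
    intro v
    have h1 := two_mul_lowDegree_le hkite hlow v
    have h2 := card_triangleNeighbors_le_degree (H := H) v
    obtain ⟨r, hr⟩ := even_card_triangleNeighbors hkite v
    have h3 := hdeg v
    have h4 : H.degree v ≤ 7 → H.lowDegree v = 0 := by
      intro hv
      refine Finset.card_eq_zero.2 (Finset.filter_eq_empty_iff.2 fun b hb hb3 => ?_)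
      have := hedge b v ((H.mem_neighborFinset v b).1 hb).symm (by omega)
      omega
    have h5 : H.degree v ≠ 1 := by
      intro hv
      obtain ⟨w, hw⟩ := (H.degree_pos_iff_exists_adj v).1 (by omega)
      have := hedge v w hw (by omega)
      have := hdeg w
      omega
    split_ifs <;> omega
  have hsum := Finset.sum_le_sum fun v (_ : v ∈ (Finset.univ : Finset V)) => hpt v
  simp only [Finset.sum_add_distrib, ← Finset.mul_sum, ← Finset.sum_filter, Finset.sum_const,
    Finset.card_univ, smul_eq_mul] at hsum
  rw [Nat.card_eq_fintype_card (α := V)] at heuler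
  omega

end Discharging

/-! ### Induction over subgraphs and the two bounds -/

section Main

variable {V : Type*}

theorem deleteEdges_lt_of_adj {H : SimpleGraph V} {s : Set (Sym2 V)} {u v : V} (huv : H.Adj u v)
    (hs : s(u, v) ∈ s) : H.deleteEdges s < H := by
  refine lt_of_le_of_ne (deleteEdges_le s) fun h => ?_
  rw [← h] at huv
  exact (deleteEdges_adj.1 huv).2 hs

theorem HasKite.mono {G H : SimpleGraph V} (h : H ≤ G) (hH : H.HasKite) : G.HasKite := by
  obtain ⟨a, b, c, d, hcd, h1, h2, h3, h4, h5⟩ := hH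
  exact ⟨a, b, c, d, hcd, h h1, h h2, h h3, h h4, h h5⟩

variable [Fintype V]

theorem card_edgeSet_lt_of_lt {H H' : SimpleGraph V} (h : H' < H) :
    Nat.card H'.edgeSet < Nat.card H.edgeSet := by
  rw [Nat.card_coe_set_eq, Nat.card_coe_set_eq]
  exact Set.ncard_lt_ncard (edgeSet_ssubset_edgeSet.2 h) (Set.toFinite _)

/-- The bound `k` and the rotation system stay those of `G` while `H` loses edges, so planarity of
subgraphs never has to be established separately. -/
theorem IsPlanar.pairChoosable {G : SimpleGraph V} (hG : G.IsPlanar) (hkite : ¬ G.HasKite) {k : ℕ}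
    (hk : 9 ≤ k) (hdegG : ∀ v, Nat.card (G.neighborSet v) ≤ k) (H : SimpleGraph V) (hH : H ≤ G) :
    H.PairChoosable (k + 1) := by
  classical
  induction hn : Nat.card H.edgeSet using Nat.strong_induction_on generalizing H with
  | _ n ih =>
    subst hn
    have hdeg : ∀ v, H.degree v ≤ k := fun v => by
      refine le_trans ?_ (hdegG v)
      rw [Nat.card_eq_fintype_card, card_neighborSet_eq_degree]
      exact degree_le_of_le hH
    have ih' : ∀ H' < H, H'.PairChoosable (k + 1) := fun H' h =>
      ih _ (card_edgeSet_lt_of_lt h) H' (h.le.trans hH) rfl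
    by_cases hne : ∃ u v, H.Adj u v
    swap
    · push Not at hne
      exact pairChoosable_of_forall_not_adj (by omega) hne
    obtain ⟨u₀, v₀, h₀⟩ := hne
    by_cases hlight : ∃ u v, H.Adj u v ∧ H.degree u ≤ 4 ∧ H.degree u + H.degree v ≤ k + 1
    · obtain ⟨u, v, huv, hu, huv'⟩ := hlight
      exact PairChoosable.of_deleteEdge huv (by omega) huv'
        (ih' _ (deleteEdges_lt_of_adj huv rfl))
    have hedge : ∀ u v, H.Adj u v → H.degree u ≤ 4 → k + 2 ≤ H.degree u + H.degree v := by
      intro u v huv hu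
      by_contra hlt
      exact hlight ⟨u, v, huv, hu, by omega⟩
    by_cases h2k : #{v | H.degree v = 2} ≤ #{v | H.degree v = k}
    · exfalso
      have hkite' : ¬ H.HasKite := fun h => hkite (h.mono hH)
      refine no_light_edge_contradiction hk hkite' hdeg hedge h2k h₀
        (hG.euler_triangles hH hkite' ?_ ?_)
      · intro v w hvw
        have h1 : 1 < H.degree v := by
          by_contra hle
          have := hedge v w hvw (by omega)
          have := hdeg w
          omega
        rw [← card_neighborFinset_eq_degree] at h1
        obtain ⟨x, hx, hxw⟩ := Finset.exists_mem_ne h1 w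
        exact ⟨x, by simpa using hx, hxw⟩
      · intro u v huv
        rw [Nat.card_eq_fintype_card, Nat.card_eq_fintype_card, card_neighborSet_eq_degree,
          card_neighborSet_eq_degree]
        by_cases hu : H.degree u ≤ 4
        · have := hedge u v huv hu
          omega
        · omega
    · push Not at h2k
      have hmem : ∀ v, v ∈ ({v | H.degree v = 2} : Finset V) ↔ H.degree v = 2 := by simp
      -- All neighbours of vertices of degree 2 have degree `k`, so here the neighbourhoods have a
      -- union smaller than their number.
      obtain ⟨S, hS, ⟨w, hw⟩, m, o, hm, ho, himg, hmo⟩ := exists_two_regular_subfamily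
        (fun v => H.neighborFinset v) {v | H.degree v = 2}
        (fun v hv => by rw [card_neighborFinset_eq_degree]; exact (hmem v).1 hv)
        (Finset.card_pos.1 (by omega)) (by
          refine (Finset.card_le_card fun x hx => ?_).trans h2k.le
          obtain ⟨w, hw, hwx⟩ := Finset.mem_biUnion.1 hx
          have h1 := (hmem w).1 hw
          have h2 := hedge w x ((H.mem_neighborFinset w x).1 hwx) (by omega)
          have h3 := hdeg x
          simp only [mem_filter, mem_univ, true_and]
          omega)
      have hS2 : ∀ v ∈ S, H.degree v = 2 := fun v hv => (hmem v).1 (hS hv)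
      refine PairChoosable.of_two_regular (by omega) S m o hm ho himg (fun w hw => ?_) ?_
        (fun v => Nat.lt_succ_of_le (hdeg v)) (ih' _ ?_)
      · convert hmo w hw
      · intro u hu v hv huv
        have h1 := hS2 u hu
        have h2 := hS2 v hv
        have := hedge u v huv (by omega)
        omega
      · obtain ⟨x, hx⟩ := (H.degree_pos_iff_exists_adj w).1 (by rw [hS2 w hw]; omega)
        exact deleteEdges_lt_of_adj hx ⟨w, hw, Sym2.mem_mk_left _ _⟩

theorem TotalChoosable.degree_lt {G : SimpleGraph V} [DecidableRel G.Adj] {k : ℕ}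
    (h : G.TotalChoosable k) (v : V) : G.degree v < k := by
  obtain ⟨c, hc, hcL⟩ := h (fun _ => Finset.range k) (fun _ => by simp)
  let x : Option (G.neighborSet v) → V ⊕ G.edgeSet := fun o =>
    o.elim (Sum.inl v) fun w => Sum.inr ⟨s(v, w.1), w.2⟩
  have hinj : Function.Injective fun o => (⟨c (x o), Finset.mem_range.1 (hcL _)⟩ : Fin k) := by
    rintro (_ | a) (_ | b) hab
    · rfl
    · exact absurd (Fin.mk.inj hab) (hc.vertex_edge v _ (Sym2.mem_mk_left _ _))
    · exact absurd (Fin.mk.inj hab).symm (hc.vertex_edge v _ (Sym2.mem_mk_left _ _))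
    · by_contra hne
      refine hc.edge_edge ⟨s(v, a.1), a.2⟩ ⟨s(v, b.1), b.2⟩ (fun he => hne ?_)
        ⟨v, Sym2.mem_mk_left _ _, Sym2.mem_mk_left _ _⟩ (Fin.mk.inj hab)
      rw [Subtype.ext (Sym2.congr_right.1 (Subtype.mk.inj he))]
  have := Fintype.card_le_of_injective _ hinj
  rw [Fintype.card_option, Fintype.card_fin, card_neighborSet_eq_degree] at this
  exact this

end Main

end SimpleGraph

theorem mainTheorem3 {V : Type*} [Fintype V] (G : SimpleGraph V) [DecidableRel G.Adj]
    (hplanar : G.IsPlanar) (hkite : ¬ G.HasKite) (hdeg : 9 ≤ G.maxDegree) :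
    G.listTotalChromaticNumber = ((G.maxDegree + 1 : ℕ) : ℕ∞) := by
  refine le_antisymm ?_ ?_
  · refine iInf₂_le _ (SimpleGraph.PairChoosable.totalChoosable ?_)
    refine hplanar.pairChoosable hkite hdeg (fun v => ?_) G le_rfl
    rw [Nat.card_eq_fintype_card, SimpleGraph.card_neighborSet_eq_degree]
    exact G.degree_le_maxDegree v
  · refine le_iInf₂ fun k hk => ?_
    -- On an empty vertex set `maxDegree` is 0, so the degree hypothesis provides a vertex.
    have hne : Nonempty V := by
      by_contra hV
      rw [not_nonempty_iff] at hV
      have := G.maxDegree_le_of_forall_degree_le 0 (fun v => hV.elim v)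
      omega
    obtain ⟨v, hv⟩ := G.exists_maximal_degree_vertex
    rw [hv]
    exact_mod_cast SimpleGraph.TotalChoosable.degree_lt hk v
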